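/- Let $A_1,\dots,A_n$ be real symmetric $d\times d$ matrices, put $A(x)=x_1A_1+\dots+x_nA_n$, and let $e\in\mathbb R^n$ be such that $A(e)$ is positive definite. Let $h=\det A(x)\in\mathbb R[x_1,\dots,x_n]$ and, for $0\le k\le d$, let $D_e^kh=\bigl(\sum_{i=1}^n e_i\,\tfrac{\partial}{\partial x_i}\bigr)^k h$ be its $k$-th Renegar derivative. Then $D_e^kh$ is hyperbolic with respect to $e$ (that is, it is homogeneous, $D_e^kh(e)>0$, and for every $a\in\mathbb R^n$ the univariate polynomial $D_e^kh(te-a)$ in $t$ has only real zeros), and its hyperbolicity cone $$\{a\in\mathbb R^n:\ \text{all zeros of } D_e^kh(te-a) \text{ are nonnegative}\}$$ is a spectrahedral cone: there are an integer $N\ge 0$ and real symmetric $N\times N$ matrices $B_1,\dots,B_n$ such that this cone equals $\{a\in\mathbb R^n:\ a_1B_1+\dots+a_nB_n \text{ is positive semidefinite}\}$. Moreover, for each fixed $k$ the size of this representation is $O(d^{2k+2})$: there is a constant $C_k$ depending only on $k$ such that one can always choose $N\le C_k\,d^{2k+2}$, for all $n$, all $d\ge k$, all $A_1,\dots,A_n$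 and all $e$ as above. -/

import Mathlib

noncomputable section

/-- The linear matrix polynomial `A(x) = x₁ A₁ + ⋯ + xₙ Aₙ`, as a matrix with polynomial entries. -/
def linearPencil {n d : ℕ} (A : Fin n → Matrix (Fin d) (Fin d) ℝ) :
    Matrix (Fin d) (Fin d) (MvPolynomial (Fin n) ℝ) :=
  ∑ i, (MvPolynomial.X i : MvPolynomial (Fin n) ℝ) • (A i).map MvPolynomial.C

/-- The value `A(a) = a₁ A₁ + ⋯ + aₙ Aₙ` of the linear matrix polynomial at a point `a ∈ ℝⁿ`. -/
def pencilAt {n d : ℕ} (A : Fin n → Matrix (Fin d) (Fin d) ℝ) (a : Fin n → ℝ) :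
    Matrix (Fin d) (Fin d) ℝ :=
  ∑ i, a i • A i

/-- The directional derivative `D_e h = ∑ i, e i * ∂h/∂x_i` of a polynomial. -/
def dirDeriv {n : ℕ} (e : Fin n → ℝ) (h : MvPolynomial (Fin n) ℝ) : MvPolynomial (Fin n) ℝ :=
  ∑ i, MvPolynomial.C (e i) * MvPolynomial.pderiv i h

/-- The Renegar derivative `D_e^k h`: the `k`-fold iterate of `D_e` applied to `h`. -/
def renegarDeriv {n : ℕ} (e : Fin n → ℝ) (k : ℕ) (h : MvPolynomial (Fin n) ℝ) :
    MvPolynomial (Fin n) ℝ :=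
  (dirDeriv e)^[k] h

/-- `h` is hyperbolic with respect to `e`: it is homogeneous, `h(e) > 0`, and for every real
vector `a` all complex zeros `z` of the univariate polynomial `h(z e - a)` are real. -/
def IsHyperbolic {n : ℕ} (h : MvPolynomial (Fin n) ℝ) (e : Fin n → ℝ) : Prop :=
  (∃ m : ℕ, h.IsHomogeneous m) ∧ 0 < MvPolynomial.eval e h ∧
    ∀ (a : Fin n → ℝ) (z : ℂ),
      MvPolynomial.aeval (fun i => z * (e i : ℂ) - (a i : ℂ)) h = 0 → z.im = 0

/-- The hyperbolicity cone of `h` at `e`: all `a` such that all zeros of `h(t e - a)` are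
nonnegative. (For hyperbolic `h` all zeros are real.) -/
def hyperbolicityCone {n : ℕ} (h : MvPolynomial (Fin n) ℝ) (e : Fin n → ℝ) : Set (Fin n → ℝ) :=
  {a | ∀ t : ℝ, MvPolynomial.eval (fun i => t * e i - a i) h = 0 → 0 ≤ t}

/-- `S ⊆ ℝⁿ` is a spectrahedral cone with a representation of size `N`: there are real symmetric
`N × N` matrices `B₁, …, Bₙ` such that `S` is the set of all `a` for which
`a₁ B₁ + ⋯ + aₙ Bₙ` is positive semidefinite. -/
def IsSpectrahedralConeOfSize {n : ℕ} (S : Set (Fin n → ℝ)) (N : ℕ) : Prop :=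
  ∃ B : Fin n → Matrix (Fin N) (Fin N) ℝ,
    (∀ i, (B i).IsSymm) ∧ S = {a | (pencilAt B a).PosSemidef}

end

set_option linter.unusedSectionVars false

open Matrix Finset
open scoped Nat

/-! ### Square tensors -/

/-! A congruence taking `A(e)` to the identity turns `h(te - a)` into a positive multiple of the
characteristic polynomial of a symmetric matrix `T` depending linearly on `a`. Directional
derivatives become ordinary ones, so hyperbolicity follows from Rolle's theorem. Membership of `a`
in the cone means that the `k`-th derivative of `(-T).charpoly`, which is the product of the `X + a
i` over the eigenvalues `a i` of `T`, has no positive zero (`NoPosRoot`).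

This condition is expressed by one quadratic form, linear in `T`. Put `m = k + 1` and let `u` be a
square tensor of order `m`, alternating in rows and in columns and symmetric. Contract `u`
repeatedly, row index against column index. The `s`-fold contraction `v` contributes `tr(vᵀ (T ⊗ 1 ⊗
⋯ ⊗ 1) v)` with weight `1 / (s! (m - s)!)`; the sum over `s < m` is `contrForm`. It is nonnegative
on all such `u` exactly when `NoPosRoot` holds (`posSemidef_altGram_iff_noPosRoot`), so its Gram
matrix, of size `d ^ (2k + 2)`, gives the representation.

Reduction to set functions: the form is invariant under isometries (`contrForm_push`), so `T` may be
taken diagonal. The form then splits according to the weight `(K \ L, L \ K)` of a row set `K` and a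
column set `L`, and each block is a restriction of the form of weight `(∅, ∅)`, which is `boolForm`,
a form on functions of `m`-sets (`blockForm_insert`, `contrForm_diagonal_nonneg`).

`NoPosRoot` implies positivity, by induction on `k` (`boolForm_nonneg`). The derivative of the
product of the `X + a i` is, up to a constant, the product belonging to the compression of `diagonal
a` to the orthogonal complement of the all-ones vector. Contracting the diagonal tensor of `f` with
the all-ones vector in one row and one column slot gives a tensor of order one less, living on that
complement, whose form is a multiple of `boolForm` at `f` (`contrForm_faceTensor`). The induction
hypothesis applies to the compression.

Positivity implies `NoPosRoot`: for `g` the `k`-th derivative and `s ≥ 0`, the form of the shifted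
eigenvalues `a i + s`, evaluated at the products over complements, is a positive multiple of `g(s)
g'(s)` (`boolForm_coProd`). Hence `g ^ 2` is monotone on `[0, ∞)`, and a positive zero would force
`g = 0`. -/

theorem sum_fin_cons {ι : Type*} [Fintype ι] {M : Type*} [AddCommMonoid M] {l : ℕ}
    (G : (Fin (l + 1) → ι) → M) :
    ∑ i, G i = ∑ z, ∑ i : Fin l → ι, G (Fin.cons z i) := by
  rw [← (Fin.consEquiv (fun _ => ι)).sum_comp, Fintype.sum_prod_type]
  rfl

section Tensor

variable {ι κ μ : Type*} {l : ℕ}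

/-- The tensor product of the matrices `M 0, …, M (l - 1)`. -/
def piTensor (M : Fin l → Matrix κ ι ℝ) : Matrix (Fin l → κ) (Fin l → ι) ℝ :=
  of fun i j => ∏ q, M q (i q) (j q)

@[simp] theorem piTensor_apply (M : Fin l → Matrix κ ι ℝ) (i : Fin l → κ) (j : Fin l → ι) :
    piTensor M i j = ∏ q, M q (i q) (j q) := rfl

theorem piTensor_mul [Fintype ι] [DecidableEq ι] (M : Fin l → Matrix κ ι ℝ)
    (N : Fin l → Matrix ι μ ℝ) :
    piTensor M * piTensor N = piTensor fun q => M q * N q := by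
  ext i j
  simp only [mul_apply, piTensor_apply, ← Finset.prod_mul_distrib]
  rw [Finset.prod_univ_sum, Fintype.piFinset_univ]

theorem piTensor_one [DecidableEq ι] : piTensor (fun _ : Fin l => (1 : Matrix ι ι ℝ)) = 1 := by
  ext i j
  rw [piTensor_apply]
  by_cases h : i = j
  · subst h; simp
  · obtain ⟨q, hq⟩ := Function.ne_iff.mp h
    rw [one_apply_ne h]
    exact Finset.prod_eq_zero (Finset.mem_univ q) (one_apply_ne hq)

theorem piTensor_transpose (M : Fin l → Matrix κ ι ℝ) :
    (piTensor M)ᵀ = piTensor fun q => (M q)ᵀ := by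
  ext i j
  simp

/-- The contraction of the first row index with the first column index. -/
def contr [Fintype ι] (u : Matrix (Fin (l + 1) → ι) (Fin (l + 1) → ι) ℝ) :
    Matrix (Fin l → ι) (Fin l → ι) ℝ :=
  of fun i j => ∑ z, u (Fin.cons z i) (Fin.cons z j)

theorem contr_apply [Fintype ι] (u : Matrix (Fin (l + 1) → ι) (Fin (l + 1) → ι) ℝ) (i j) :
    contr u i j = ∑ z, u (Fin.cons z i) (Fin.cons z j) := rfl

/-- The matrix `X` acting on the first tensor factor. -/
def firstAct [DecidableEq ι] (X : Matrix ι ι ℝ) :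
    Matrix (Fin (l + 1) → ι) (Fin (l + 1) → ι) ℝ :=
  piTensor (Fin.cons X fun _ => 1)

theorem firstAct_diagonal [DecidableEq ι] (a : ι → ℝ) :
    firstAct (l := l) (diagonal a) = diagonal fun i => a (i 0) := by
  ext i j
  rw [firstAct, piTensor_apply, Fin.prod_univ_succ]
  simp only [Fin.cons_zero, Fin.cons_succ]
  by_cases h : i = j
  · subst h; simp
  · rw [diagonal_apply_ne _ h]
    obtain ⟨q, hq⟩ := Function.ne_iff.mp h
    induction q using Fin.cases with
    | zero => rw [diagonal_apply_ne _ hq, zero_mul]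
    | succ q =>
      rw [Finset.prod_eq_zero (Finset.mem_univ q), mul_zero]
      exact one_apply_ne hq

theorem firstAct_apply [DecidableEq ι] (X : Matrix ι ι ℝ) (i j : Fin (l + 1) → ι) :
    firstAct X i j = X (i 0) (j 0) * ∏ q : Fin l, (1 : Matrix ι ι ℝ) (i q.succ) (j q.succ) := by
  rw [firstAct, piTensor_apply, Fin.prod_univ_succ]
  simp only [Fin.cons_zero, Fin.cons_succ]

theorem firstAct_add [DecidableEq ι] (X Y : Matrix ι ι ℝ) :
    firstAct (l := l) (X + Y) = firstAct X + firstAct Y := by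
  ext i j
  simp only [firstAct_apply, Matrix.add_apply, add_mul]

theorem firstAct_smul [DecidableEq ι] (c : ℝ) (X : Matrix ι ι ℝ) :
    firstAct (l := l) (c • X) = c • firstAct X := by
  ext i j
  simp only [firstAct_apply, Matrix.smul_apply, smul_eq_mul, mul_assoc]

theorem firstAct_transpose [DecidableEq ι] (X : Matrix ι ι ℝ) :
    (firstAct (l := l) X)ᵀ = firstAct Xᵀ := by
  ext i j
  rw [Matrix.transpose_apply, firstAct_apply, firstAct_apply]
  congr 1
  refine Finset.prod_congr rfl fun q _ => ?_
  rw [← Matrix.transpose_apply 1, Matrix.transpose_one]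

variable [Fintype ι] [DecidableEq ι]

/-- The pairing of `u` with `v` in which `X` acts on the first row index of `v`. -/
def energy (X : Matrix ι ι ℝ) (u v : Matrix (Fin (l + 1) → ι) (Fin (l + 1) → ι) ℝ) : ℝ :=
  trace (uᵀ * firstAct X * v)

/-- The weighted sum of the energies of the iterated contractions. -/
noncomputable def contrForm (X : Matrix ι ι ℝ) : (l r : ℕ) → (u v : Matrix (Fin l → ι) (Fin l → ι) ℝ) → ℝ
  | 0, _, _, _ => 0
  | l + 1, r, u, v => ((r ! * (l + 1)! : ℕ) : ℝ)⁻¹ * energy X u v +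
      contrForm X l (r + 1) (contr u) (contr v)

theorem contr_add (u v : Matrix (Fin (l + 1) → ι) (Fin (l + 1) → ι) ℝ) :
    contr (u + v) = contr u + contr v := by
  ext i j
  simp [contr_apply, Finset.sum_add_distrib]

theorem contr_smul (c : ℝ) (u : Matrix (Fin (l + 1) → ι) (Fin (l + 1) → ι) ℝ) :
    contr (c • u) = c • contr u := by
  ext i j
  simp [contr_apply, Finset.mul_sum]

theorem contrForm_add_left (X : Matrix ι ι ℝ) (l r : ℕ) (u u' v) :
    contrForm X l r (u + u') v = contrForm X l r u v + contrForm X l r u' v := by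
  induction l generalizing r with
  | zero => simp [contrForm]
  | succ l ih =>
    simp only [contrForm, energy, contr_add, ih, transpose_add, Matrix.add_mul, trace_add]
    ring

theorem contrForm_smul_left (X : Matrix ι ι ℝ) (l r : ℕ) (c : ℝ) (u v) :
    contrForm X l r (c • u) v = c * contrForm X l r u v := by
  induction l generalizing r with
  | zero => simp [contrForm]
  | succ l ih =>
    simp only [contrForm, energy, contr_smul, ih, transpose_smul, Matrix.smul_mul, trace_smul,
      smul_eq_mul]
    ring

theorem contrForm_comm {X : Matrix ι ι ℝ} (hX : X.IsSymm) (l r : ℕ) (u v) :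
    contrForm X l r u v = contrForm X l r v u := by
  induction l generalizing r with
  | zero => simp [contrForm]
  | succ l ih =>
    simp only [contrForm, energy, ih _ (contr u)]
    rw [← trace_transpose (uᵀ * firstAct X * v)]
    simp only [transpose_mul, transpose_transpose, firstAct_transpose, hX.eq, Matrix.mul_assoc]

theorem contrForm_add_matrix (X Y : Matrix ι ι ℝ) (l r : ℕ) (u v) :
    contrForm (X + Y) l r u v = contrForm X l r u v + contrForm Y l r u v := by
  induction l generalizing r with
  | zero => simp [contrForm]
  | succ l ih =>
    simp only [contrForm, energy, ih, firstAct_add, Matrix.add_mul, Matrix.mul_add, trace_add]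
    ring

theorem contrForm_smul_matrix (c : ℝ) (X : Matrix ι ι ℝ) (l r : ℕ) (u v) :
    contrForm (c • X) l r u v = c * contrForm X l r u v := by
  induction l generalizing r with
  | zero => simp [contrForm]
  | succ l ih =>
    simp only [contrForm, energy, ih, firstAct_smul, Matrix.smul_mul, Matrix.mul_smul, trace_smul,
      smul_eq_mul]
    ring

/-- Every energy at the identity is a sum of squares. This allows adding a nonnegative multiple of
the identity to `T` without losing positivity. -/
theorem contrForm_one_nonneg (l r : ℕ) (u) : 0 ≤ contrForm (1 : Matrix ι ι ℝ) l r u u := by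
  induction l generalizing r with
  | zero => simp [contrForm]
  | succ l ih =>
    refine add_nonneg (mul_nonneg (by positivity) ?_) (ih _ _)
    rw [energy, ← diagonal_one, firstAct_diagonal, diagonal_one, Matrix.mul_one, trace]
    refine Finset.sum_nonneg fun j _ => ?_
    rw [diag_apply, mul_apply]
    exact Finset.sum_nonneg fun i _ => mul_self_nonneg _

variable [Fintype κ] [DecidableEq κ]

/-- The `l`-th tensor power of a matrix. -/
def tensorPow (l : ℕ) (C : Matrix κ ι ℝ) : Matrix (Fin l → κ) (Fin l → ι) ℝ :=
  piTensor fun _ => C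

/-- The action of a matrix on every index of a square tensor. -/
def push (C : Matrix κ ι ℝ) (u : Matrix (Fin l → ι) (Fin l → ι) ℝ) :
    Matrix (Fin l → κ) (Fin l → κ) ℝ :=
  tensorPow l C * u * (tensorPow l C)ᵀ

theorem tensorPow_cons (C : Matrix κ ι ℝ) (z : κ) (x : ι) (i : Fin l → κ) (j : Fin l → ι) :
    tensorPow (l + 1) C (Fin.cons z i : Fin (l + 1) → κ) (Fin.cons x j : Fin (l + 1) → ι) =
      C z x * tensorPow _ C i j := by
  simp [tensorPow, Fin.prod_univ_succ]

theorem push_apply (C : Matrix κ ι ℝ) (u : Matrix (Fin l → ι) (Fin l → ι) ℝ) (i j) :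
    push C u i j =
      ∑ x, ∑ y, tensorPow _ C i x * tensorPow _ C j y * u x y := by
  simp only [push, mul_apply, Finset.sum_mul, transpose_apply]
  rw [Finset.sum_comm]
  refine Finset.sum_congr rfl fun x _ => Finset.sum_congr rfl fun y _ => ?_
  ring

/-- Contraction pairs two indices by the standard inner product, which an isometry preserves. -/
theorem contr_push {C : Matrix κ ι ℝ} (hC : Cᵀ * C = 1)
    (u : Matrix (Fin (l + 1) → ι) (Fin (l + 1) → ι) ℝ) :
    contr (push C u) = push C (contr u) := by
  have hC' (x y : ι) : ∑ z, C z x * C z y = if x = y then 1 else 0 := by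
    rw [← one_apply, ← hC, mul_apply]; rfl
  ext i j
  simp only [contr_apply, push_apply]
  calc _ = ∑ z, ∑ x0, ∑ x, ∑ y0, ∑ y, (C z x0 * C z y0) * (tensorPow _ C i x *
            tensorPow _ C j y * u (Fin.cons x0 x) (Fin.cons y0 y)) := by
        refine Finset.sum_congr rfl fun z _ => ?_
        rw [sum_fin_cons]
        refine Finset.sum_congr rfl fun x0 _ => Finset.sum_congr rfl fun x _ => ?_
        rw [sum_fin_cons]
        refine Finset.sum_congr rfl fun y0 _ => Finset.sum_congr rfl fun y _ => ?_
        rw [tensorPow_cons, tensorPow_cons]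
        ring
    _ = ∑ x0, ∑ x, ∑ y0, ∑ y, (∑ z, C z x0 * C z y0) * (tensorPow _ C i x *
            tensorPow _ C j y * u (Fin.cons x0 x) (Fin.cons y0 y)) := by
        simp only [Finset.sum_mul]
        rw [Finset.sum_comm]
        refine Finset.sum_congr rfl fun x0 _ => ?_
        rw [Finset.sum_comm]
        refine Finset.sum_congr rfl fun x _ => ?_
        rw [Finset.sum_comm]
        refine Finset.sum_congr rfl fun y0 _ => ?_
        rw [Finset.sum_comm]
    _ = ∑ x0, ∑ x, ∑ y, tensorPow _ C i x *
            tensorPow _ C j y * u (Fin.cons x0 x) (Fin.cons x0 y) := by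
        refine Finset.sum_congr rfl fun x0 _ => Finset.sum_congr rfl fun x _ => ?_
        rw [Finset.sum_comm]
        refine Finset.sum_congr rfl fun y _ => ?_
        simp [hC']
    _ = _ := by
        rw [Finset.sum_comm]
        refine Finset.sum_congr rfl fun x _ => ?_
        rw [Finset.sum_comm]
        simp only [Finset.mul_sum]

theorem energy_push {C : Matrix κ ι ℝ} (hC : Cᵀ * C = 1) (Y : Matrix κ κ ℝ)
    (u v : Matrix (Fin (l + 1) → ι) (Fin (l + 1) → ι) ℝ) :
    energy Y (push C u) (push C v) = energy (Cᵀ * Y * C) u v := by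
  have h1 : (tensorPow (l + 1) C)ᵀ * firstAct (l := l) Y * tensorPow (l + 1) C =
      firstAct (Cᵀ * Y * C) := by
    rw [tensorPow, piTensor_transpose, firstAct, firstAct, piTensor_mul, piTensor_mul]
    congr 1
    funext q
    refine q.cases ?_ (fun q => ?_)
    · simp
    · simp [hC]
  have h2 : (tensorPow (l + 1) C)ᵀ * tensorPow (l + 1) C = (1 : Matrix _ _ ℝ) := by
    rw [tensorPow, piTensor_transpose, piTensor_mul]
    simp only [hC]
    exact piTensor_one
  rw [energy, energy, ← h1, push, push]
  set K := tensorPow (l + 1) C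
  set Z := firstAct (l := l) Y
  calc trace ((K * u * Kᵀ)ᵀ * Z * (K * v * Kᵀ))
      = trace (K * (uᵀ * (Kᵀ * Z * K) * v * Kᵀ)) := by
        simp only [transpose_mul, transpose_transpose, Matrix.mul_assoc]
    _ = trace (uᵀ * (Kᵀ * Z * K) * v * (Kᵀ * K)) := by
        rw [trace_mul_comm]; simp only [Matrix.mul_assoc]
    _ = _ := by rw [h2, Matrix.mul_one]

/-- `C` need not be square: orthogonal matrices give diagonalization, and an isometric embedding of
a hyperplane gives the compression used in the induction on the order of the derivative. -/
theorem contrForm_push {C : Matrix κ ι ℝ} (hC : Cᵀ * C = 1) (Y : Matrix κ κ ℝ) (l r : ℕ)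
    (u v : Matrix (Fin l → ι) (Fin l → ι) ℝ) :
    contrForm Y l r (push C u) (push C v) = contrForm (Cᵀ * Y * C) l r u v := by
  induction l generalizing r with
  | zero => rfl
  | succ l ih => simp only [contrForm, energy_push hC, contr_push hC, ih]

/-- A square tensor is alternating if it is alternating in its row indices and symmetric under
the exchange of rows and columns. -/
structure IsAltSymm (u : Matrix (Fin l → ι) (Fin l → ι) ℝ) : Prop where
  perm : ∀ (σ : Equiv.Perm (Fin l)) (i j : Fin l → ι),
    u (i ∘ σ) j = (Equiv.Perm.sign σ : ℤ) * u i j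
  symm : ∀ i j, u i j = u j i

theorem IsAltSymm.perm_right {u : Matrix (Fin l → ι) (Fin l → ι) ℝ} (hu : IsAltSymm u)
    (σ : Equiv.Perm (Fin l)) (i j : Fin l → ι) :
    u i (j ∘ σ) = (Equiv.Perm.sign σ : ℤ) * u i j := by
  rw [hu.symm, hu.perm, hu.symm]

theorem tensorPow_comp_perm (C : Matrix κ ι ℝ) (σ : Equiv.Perm (Fin l)) (i : Fin l → κ)
    (x : Fin l → ι) :
    tensorPow _ C (i ∘ σ) (x ∘ σ) = tensorPow _ C i x := by
  simp only [tensorPow, piTensor_apply, Function.comp]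
  exact Equiv.prod_comp σ fun q => C (i q) (x q)

theorem IsAltSymm.push {u : Matrix (Fin l → ι) (Fin l → ι) ℝ} (hu : IsAltSymm u)
    (C : Matrix κ ι ℝ) : IsAltSymm (push C u) where
  perm σ i j := by
    rw [push_apply, push_apply, Finset.mul_sum,
      ← Equiv.sum_comp (Equiv.arrowCongr σ.symm (Equiv.refl ι))]
    refine Finset.sum_congr rfl fun x _ => ?_
    rw [Finset.mul_sum]
    refine Finset.sum_congr rfl fun y _ => ?_
    have : Equiv.arrowCongr σ.symm (Equiv.refl ι) x = x ∘ σ := by ext; simp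
    rw [this, tensorPow_comp_perm, hu.perm]
    ring
  symm i j := by
    rw [push_apply, push_apply, Finset.sum_comm]
    refine Finset.sum_congr rfl fun x _ => Finset.sum_congr rfl fun y _ => ?_
    rw [hu.symm]
    ring

end Tensor

/-! ### Quadratic forms on set functions -/

section SetFunctions

variable {ι : Type*} [Fintype ι] [DecidableEq ι]

/-- The sum of `f` over all supersets of `L` with `M` elements. -/
def supSum (M : ℕ) (f : Finset ι → ℝ) (L : Finset ι) : ℝ :=
  ∑ S with L ⊆ S ∧ S.card = M, f S

theorem supSum_sub (M : ℕ) (f g : Finset ι → ℝ) (L : Finset ι) :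
    supSum M (f - g) L = supSum M f L - supSum M g L := by
  simp [supSum]

theorem supSum_eq_zero {M : ℕ} {f : Finset ι → ℝ} {L : Finset ι}
    (h : ∀ S, L ⊆ S → f S = 0) : supSum M f L = 0 :=
  Finset.sum_eq_zero fun S hS => h S (by simp at hS; exact hS.1)

theorem supSum_of_card_lt {M : ℕ} (f : Finset ι → ℝ) {L : Finset ι} (h : M < L.card) :
    supSum M f L = 0 := by
  refine Finset.sum_eq_zero fun S hS => ?_
  simp only [mem_filter, mem_univ, true_and] at hS
  have := card_le_card hS.1
  omega

theorem supSum_of_card_eq {M : ℕ} (f : Finset ι → ℝ) {L : Finset ι} (h : L.card = M) :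
    supSum M f L = f L := by
  rw [supSum, Finset.sum_eq_single_of_mem L (by simp [h])]
  intro S hS hne
  simp only [mem_filter, mem_univ, true_and] at hS
  exact absurd (eq_of_subset_of_card_le hS.1 (by omega)).symm hne

/-- Double counting: a superset `S` of `L` with `M` elements is met once for each element of `S \
L`. -/
theorem sum_supSum_insert (M : ℕ) (f : Finset ι → ℝ) (L : Finset ι) :
    ∑ z ∈ Lᶜ, supSum M f (insert z L) = ((M - L.card : ℕ) : ℝ) * supSum M f L := by
  simp only [supSum, Finset.sum_filter, Finset.mul_sum]
  rw [Finset.sum_comm]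
  refine Finset.sum_congr rfl fun S _ => ?_
  by_cases h : L ⊆ S ∧ S.card = M
  · rw [if_pos h, ← Finset.sum_filter, Finset.sum_const, nsmul_eq_mul]
    have : {z ∈ Lᶜ | insert z L ⊆ S ∧ S.card = M} = S \ L := by
      ext z
      simp only [mem_filter, mem_compl, mem_sdiff, insert_subset_iff]
      tauto
    rw [this, card_sdiff_of_subset h.1, h.2]
  · rw [if_neg h, mul_zero]
    refine Finset.sum_eq_zero fun z _ => if_neg fun h' => h ⟨?_, h'.2⟩
    exact (subset_insert _ _).trans h'.1

/-- The diagonal part of the contraction form. -/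
def boolForm (M : ℕ) (a : ι → ℝ) (f : Finset ι → ℝ) : ℝ :=
  ∑ L, (((L.card - 1)! * (M - L.card)! : ℕ) : ℝ) * (∑ i ∈ L, a i) * supSum M f L ^ 2

/-- The part of the contraction form belonging to a weight `(P, R)`. -/
noncomputable def blockForm (P R : Finset ι) (M : ℕ) (a : ι → ℝ) (U : Finset ι → ℝ) : ℝ :=
  ∑ J ∈ (P ∪ R)ᶜ.powerset, (((P.card + J.card - 1)! * (M - J.card)! : ℕ) : ℝ) *
    ((∑ i ∈ P, a i + ∑ i ∈ R, a i) / 2 + ∑ i ∈ J, a i) * supSum M U J ^ 2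

/-- Multiplication of a set function by the variable `i`. -/
def insFun (i : ι) (U : Finset ι → ℝ) (S : Finset ι) : ℝ :=
  if i ∈ S then U (S.erase i) else 0

/-- Erasing `i` matches the sets that contribute on the left with the sets avoiding `i` on the
right, whether or not `i` lies in `L`. -/
theorem supSum_insFun {i : ι} {U : Finset ι → ℝ} (hU : ∀ S, i ∈ S → U S = 0) (M : ℕ)
    (L : Finset ι) : supSum (M + 1) (insFun i U) L = supSum M U (L.erase i) := by
  have h1 : supSum (M + 1) (insFun i U) L =
      ∑ S with (L ⊆ S ∧ S.card = M + 1) ∧ i ∈ S, U (S.erase i) := by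
    rw [supSum, ← Finset.filter_filter (fun S => L ⊆ S ∧ S.card = M + 1) (fun S => i ∈ S),
      Finset.sum_filter (fun S => i ∈ S)]
    rfl
  have h2 : supSum M U (L.erase i) =
      ∑ S with (L.erase i ⊆ S ∧ S.card = M) ∧ i ∉ S, U S := by
    rw [supSum, ← Finset.filter_filter (fun S => L.erase i ⊆ S ∧ S.card = M) (fun S => i ∉ S),
      Finset.sum_filter (fun S => i ∉ S)]
    refine Finset.sum_congr rfl fun S _ => ?_
    by_cases h : i ∈ S
    · simp [h, hU S h]
    · simp [h]
  rw [h1, h2]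
  refine Finset.sum_nbij' (fun S => S.erase i) (fun S => insert i S) ?_ ?_ ?_ ?_ ?_
  · intro S hS
    simp only [mem_filter, mem_univ, true_and] at hS ⊢
    refine ⟨⟨erase_subset_erase _ hS.1.1, ?_⟩, notMem_erase _ _⟩
    rw [card_erase_of_mem hS.2, hS.1.2]; rfl
  · intro S hS
    simp only [mem_filter, mem_univ, true_and] at hS ⊢
    refine ⟨⟨?_, ?_⟩, mem_insert_self _ _⟩
    · exact subset_insert_iff.mpr hS.1.1
    · rw [card_insert_of_notMem hS.2, hS.1.2]
  · intro S hS
    simp only [mem_filter, mem_univ, true_and] at hS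
    exact insert_erase hS.2
  · intro S hS
    simp only [mem_filter, mem_univ, true_and] at hS
    exact erase_insert hS.2
  · intro S _
    rfl

/-- Group the subsets of the complement of `P ∪ R` into `J`, `J ∪ {i}`, `J ∪ {j}`, `J ∪ {i, j}` with
`J` avoiding `i` and `j`. On the first the two parts of the difference cancel, and on the last both
vanish. The two middle ones each give the square of `supSum M U J`, and their linear coefficients,
involving `a i` and `a j` respectively, add up to twice the coefficient for the enlarged weight. -/
theorem blockForm_insert {P R : Finset ι} {i j : ι} (hij : i ≠ j) (hiP : i ∉ P) (hjP : j ∉ P)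
    (hiR : i ∉ R) (hjR : j ∉ R) (M : ℕ) (a : ι → ℝ) {U : Finset ι → ℝ}
    (hi : ∀ S, i ∈ S → U S = 0) (hj : ∀ S, j ∈ S → U S = 0) :
    blockForm P R (M + 1) a (insFun i U - insFun j U) =
      2 * blockForm (insert i P) (insert j R) M a U := by
  set A := (insert i P ∪ insert j R)ᶜ with hA
  have hc : (P ∪ R)ᶜ = insert i (insert j A) := by
    ext x
    simp only [hA, mem_compl, mem_union, mem_insert]
    by_cases hxi : x = i
    · subst hxi; simp [hiP, hiR]
    · by_cases hxj : x = j
      · subst hxj; simp [hjP, hjR]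
      · simp [hxi, hxj]
  have hiA : i ∉ A := by simp [hA]
  have hjA : j ∉ A := by simp [hA]
  have zi : ∀ L, i ∈ L → supSum M U L = 0 := fun L hL => supSum_eq_zero fun S hS => hi S (hS hL)
  have zj : ∀ L, j ∈ L → supSum M U L = 0 := fun L hL => supSum_eq_zero fun S hS => hj S (hS hL)
  rw [blockForm, blockForm, hc, sum_powerset_insert (by simp [hij, hiA]), sum_powerset_insert hjA,
    sum_powerset_insert hjA, Finset.mul_sum, ← Finset.sum_add_distrib, ← Finset.sum_add_distrib,
    ← Finset.sum_add_distrib]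
  refine Finset.sum_congr rfl fun J hJ => ?_
  have hJA := mem_powerset.mp hJ
  have hiJ : i ∉ J := fun h => hiA (hJA h)
  have hjJ : j ∉ J := fun h => hjA (hJA h)
  have hijJ : i ∉ insert j J := by simp [hij, hiJ]
  simp only [supSum_sub, supSum_insFun hi, supSum_insFun hj]
  rw [erase_eq_of_notMem hiJ, erase_eq_of_notMem hjJ, erase_insert hjJ, erase_insert hijJ,
    erase_insert hiJ, erase_eq_of_notMem hijJ, zj (insert j J) (mem_insert_self _ _),
    erase_eq_of_notMem (by simp [hij.symm, hjJ] : j ∉ insert i J),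
    zi (insert i J) (mem_insert_self _ _),
    zi ((insert i (insert j J)).erase j) (by simp [hij]),
    card_insert_of_notMem hijJ, card_insert_of_notMem hiJ, card_insert_of_notMem hjJ,
    card_insert_of_notMem hiP, sum_insert hiP, sum_insert hjR, sum_insert hiJ, sum_insert hjJ]
  have e1 : P.card + (J.card + 1) - 1 = P.card + J.card := by omega
  have e2 : P.card + 1 + J.card - 1 = P.card + J.card := by omega
  have e3 : M + 1 - (J.card + 1) = M - J.card := by omega
  rw [e1, e2, e3]
  ring

/-- Removing a pair `(i, j)` from the weight raises the order `M` by one and keeps `M + p` fixed;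
the block of empty weight is `boolForm` itself. -/
theorem blockForm_nonneg {a : ι → ℝ} (p : ℕ) : ∀ {P R : Finset ι}, Disjoint P R → P.card = p →
    R.card = p → ∀ (M : ℕ) (U : Finset ι → ℝ), (∀ S, ¬ Disjoint S (P ∪ R) → U S = 0) →
    (∀ f, 0 ≤ boolForm (M + p) a f) → 0 ≤ blockForm P R M a U := by
  induction p with
  | zero =>
    intro P R _ hP hR M U _ h
    rw [card_eq_zero] at hP hR
    subst hP hR
    have := h U
    simpa [blockForm, boolForm] using this
  | succ p ih =>
    intro P R hd hP hR M U hU h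
    obtain ⟨i, P, hiP, rfl, hP'⟩ := card_eq_succ.mp hP
    obtain ⟨j, R, hjR, rfl, hR'⟩ := card_eq_succ.mp hR
    simp only [disjoint_insert_left, disjoint_insert_right, mem_insert, not_or] at hd
    obtain ⟨⟨hji, hjP⟩, hiR, hd⟩ := hd
    have hij := Ne.symm hji
    have hi : ∀ S, i ∈ S → U S = 0 := fun S hS =>
      hU S (not_disjoint_iff.mpr ⟨i, hS, by simp⟩)
    have hj : ∀ S, j ∈ S → U S = 0 := fun S hS =>
      hU S (not_disjoint_iff.mpr ⟨j, hS, by simp⟩)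
    have key := blockForm_insert hij hiP hjP hiR hjR M a hi hj
    have aux : ∀ x S, ¬ Disjoint S (P ∪ R) → x ∉ P → x ∉ R → insFun x U S = 0 := by
      intro x S hS hxP hxR
      obtain ⟨y, hyS, hy⟩ := not_disjoint_iff.mp hS
      rw [insFun]
      split_ifs with hx
      · refine hU _ (not_disjoint_iff.mpr ⟨y, mem_erase.mpr ⟨?_, hyS⟩, ?_⟩)
        · rintro rfl
          simp [hxP, hxR] at hy
        · simp only [mem_union, mem_insert] at hy ⊢
          tauto
      · rfl
    have := ih hd hP' hR' (M + 1) (insFun i U - insFun j U) (fun S hS => by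
      rw [Pi.sub_apply, aux i S hS hiP hiR, aux j S hS hjP hjR, sub_zero])
      (by rwa [show M + 1 + p = M + (p + 1) by omega])
    linarith

end SetFunctions

/-! ### Tensors as functions on lists -/

section Lists

variable {ι : Type*} [Fintype ι] [DecidableEq ι] {l : ℕ}

/-- A square tensor as a function of two lists of indices. -/
def toLists (u : Matrix (Fin l → ι) (Fin l → ι) ℝ) (x y : List ι) : ℝ :=
  if h : x.length = l ∧ y.length = l then
    u (fun q => x.get (q.cast h.1.symm)) (fun q => y.get (q.cast h.2.symm)) else 0

/-- Contraction of functions of two lists. -/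
def listContr (w : List ι → List ι → ℝ) (x y : List ι) : ℝ := ∑ z, w (z :: x) (z :: y)

theorem toLists_ofFn (u : Matrix (Fin l → ι) (Fin l → ι) ℝ) (i j : Fin l → ι) :
    toLists u (List.ofFn i) (List.ofFn j) = u i j := by
  rw [toLists, dif_pos (by simp)]
  congr 1 <;> (ext q; simp)

theorem toLists_of_length_ne (u : Matrix (Fin l → ι) (Fin l → ι) ℝ) {x y : List ι}
    (h : x.length ≠ l) : toLists u x y = 0 :=
  dif_neg fun h' => h h'.1

theorem toLists_of_length_ne' (u : Matrix (Fin l → ι) (Fin l → ι) ℝ) {x y : List ι}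
    (h : y.length ≠ l) : toLists u x y = 0 :=
  dif_neg fun h' => h h'.2

theorem List.exists_ofFn_of_length {α : Type*} {x : List α} {l : ℕ} (h : x.length = l) :
    ∃ i : Fin l → α, List.ofFn i = x := by
  subst h
  exact ⟨x.get, List.ofFn_get x⟩

/-- On lists, iterated contraction is the iteration of a single map, whereas on tensors each
contraction changes the type. -/
theorem toLists_contr (u : Matrix (Fin (l + 1) → ι) (Fin (l + 1) → ι) ℝ) :
    toLists (contr u) = listContr (toLists u) := by
  ext x y
  rw [listContr]
  by_cases hx : x.length = l
  · by_cases hy : y.length = l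
    · obtain ⟨i, rfl⟩ := List.exists_ofFn_of_length hx
      obtain ⟨j, rfl⟩ := List.exists_ofFn_of_length hy
      rw [toLists_ofFn, contr_apply]
      refine Finset.sum_congr rfl fun z _ => ?_
      rw [← toLists_ofFn u, List.ofFn_cons, List.ofFn_cons]
    · rw [toLists_of_length_ne' _ hy]
      exact (Finset.sum_eq_zero fun z _ => toLists_of_length_ne' _ (by simpa using hy)).symm
  · rw [toLists_of_length_ne _ hx]
    exact (Finset.sum_eq_zero fun z _ => toLists_of_length_ne _ (by simpa using hx)).symm

/-- Functions of two lists that are alternating in the first list and symmetric. -/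
structure IsListAlt (w : List ι → List ι → ℝ) : Prop where
  swap : ∀ p a b s y, w (p ++ a :: b :: s) y = -w (p ++ b :: a :: s) y
  symm : ∀ x y, w x y = w y x

theorem IsListAlt.swap_right {w : List ι → List ι → ℝ} (hw : IsListAlt w) (p a b s y) :
    w y (p ++ a :: b :: s) = -w y (p ++ b :: a :: s) := by
  rw [hw.symm, hw.swap, hw.symm]

theorem List.ofFn_comp_swap {α : Type*} (p : List α) (a b : α) (s : List α) {l : ℕ}
    {i : Fin l → α} (hi : List.ofFn i = p ++ a :: b :: s) :
    ∃ q q' : Fin l, q ≠ q' ∧ List.ofFn (i ∘ Equiv.swap q q') = p ++ b :: a :: s := by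
  have hl : l = p.length + (s.length + 2) := by
    have := congrArg List.length hi
    simpa using this
  have hget : ∀ (q : ℕ) (hq : q < l), i ⟨q, hq⟩ =
      (p ++ a :: b :: s)[q]'(by simp; omega) := by
    intro q hq
    simp [← hi]
  refine ⟨⟨p.length, by omega⟩, ⟨p.length + 1, by omega⟩, by simp, ?_⟩
  refine List.ext_getElem (by simp; omega) fun q h1 h2 => ?_
  simp only [List.length_ofFn] at h1
  rw [List.getElem_ofFn, Function.comp]
  rcases lt_trichotomy q p.length with h | h | h
  · rw [Equiv.swap_apply_of_ne_of_ne (by simp; omega) (by simp; omega), hget,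
      List.getElem_append_left h, List.getElem_append_left h]
  · subst h
    rw [Equiv.swap_apply_left, hget]
    simp
  · by_cases h' : q = p.length + 1
    · subst h'
      rw [Equiv.swap_apply_right, hget]
      simp
    · obtain ⟨c, rfl⟩ : ∃ c, q = p.length + (c + 2) := ⟨q - p.length - 2, by omega⟩
      rw [Equiv.swap_apply_of_ne_of_ne (by simp) (by simp), hget]
      simp

theorem IsAltSymm.isListAlt {u : Matrix (Fin l → ι) (Fin l → ι) ℝ} (hu : IsAltSymm u) :
    IsListAlt (toLists u) where
  swap p a b s y := by
    by_cases hx : (p ++ a :: b :: s).length = l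
    · by_cases hy : y.length = l
      · obtain ⟨i, hi⟩ := List.exists_ofFn_of_length hx
        obtain ⟨j, rfl⟩ := List.exists_ofFn_of_length hy
        obtain ⟨q, q', hne, h⟩ := List.ofFn_comp_swap p a b s hi
        rw [← hi, ← h, toLists_ofFn, toLists_ofFn, hu.perm, Equiv.Perm.sign_swap hne]
        simp
      · rw [toLists_of_length_ne' _ hy, toLists_of_length_ne' _ hy, neg_zero]
    · rw [toLists_of_length_ne _ hx, toLists_of_length_ne _ (by simpa using hx), neg_zero]
  symm x y := by
    rw [toLists, toLists]
    split_ifs with h1 h2 h2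
    · exact hu.symm _ _
    · exact absurd h1.symm h2
    · exact absurd h2.symm h1
    · rfl

namespace IsListAlt

variable {w : List ι → List ι → ℝ}

protected theorem listContr (hw : IsListAlt w) : IsListAlt (listContr w) where
  swap p a b s y := by
    simp only [_root_.listContr, ← Finset.sum_neg_distrib]
    exact Finset.sum_congr rfl fun z _ => hw.swap (z :: p) a b s _
  symm x y := Finset.sum_congr rfl fun z _ => hw.symm _ _

theorem iterate (hw : IsListAlt w) (s : ℕ) : IsListAlt (_root_.listContr^[s] w) := by
  induction s with
  | zero => exact hw
  | succ s ih => rw [Function.iterate_succ_apply']; exact ih.listContr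

theorem sq_perm (hw : IsListAlt w) {x x' : List ι} (h : x.Perm x') (y : List ι) :
    w x y ^ 2 = w x' y ^ 2 := by
  -- An arbitrary prefix lets the induction on permutations pass under a head element.
  suffices ∀ p, w (p ++ x) y ^ 2 = w (p ++ x') y ^ 2 from this []
  induction h with
  | nil => intro p; rfl
  | cons a _ ih => intro p; simpa using ih (p ++ [a])
  | swap a b s => intro p; rw [hw.swap, neg_sq]
  | trans _ _ ih1 ih2 => intro p; rw [ih1, ih2]

theorem sq_perm₂ (hw : IsListAlt w) {x x' y y' : List ι} (h : x.Perm x') (h' : y.Perm y') :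
    w x y ^ 2 = w x' y' ^ 2 := by
  rw [hw.sq_perm h, hw.symm, hw.sq_perm h', hw.symm]

/-- The same permutation of rows and columns produces the same sign twice. -/
theorem perm_both (hw : IsListAlt w) {x x' : List ι} (h : x.Perm x') (s s' : List ι) :
    w (x ++ s) (x ++ s') = w (x' ++ s) (x' ++ s') := by
  suffices ∀ p, w (p ++ (x ++ s)) (p ++ (x ++ s')) = w (p ++ (x' ++ s)) (p ++ (x' ++ s')) from
    this []
  induction h with
  | nil => intro p; rfl
  | cons a _ ih => intro p; simpa using ih (p ++ [a])
  | swap a b t =>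
    intro p
    simp only [List.cons_append]
    rw [hw.swap, hw.swap_right, neg_neg]
  | trans _ _ ih1 ih2 => intro p; rw [ih1, ih2]

theorem eq_zero_of_not_nodup (hw : IsListAlt w) {x : List ι} (h : ¬ x.Nodup) (y : List ι) :
    w x y = 0 := by
  rw [← List.exists_duplicate_iff_not_nodup] at h
  obtain ⟨a, ha⟩ := h
  obtain ⟨s, hs⟩ := (List.duplicate_iff_sublist.mp ha).exists_perm_append
  have h1 := hw.sq_perm hs y
  have h2 := hw.swap [] a a s y
  have h3 : w ([a, a] ++ s) y = 0 := by
    simp only [List.nil_append] at h2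
    simp only [List.cons_append, List.nil_append]
    linarith
  rw [h3] at h1
  simpa using h1

theorem eq_zero_of_not_nodup' (hw : IsListAlt w) {y : List ι} (h : ¬ y.Nodup) (x : List ι) :
    w x y = 0 := by
  rw [hw.symm, hw.eq_zero_of_not_nodup h]

end IsListAlt

/-- The set function obtained from `w` by fixing the part `(P, R)` of the weight. -/
noncomputable def weightFun (w : List ι → List ι → ℝ) (P R Z : Finset ι) : ℝ :=
  w (Z.toList ++ P.toList) (Z.toList ++ R.toList)

theorem weightFun_comm {w : List ι → List ι → ℝ} (hw : IsListAlt w) (P R : Finset ι) :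
    weightFun w P R = weightFun w R P := by
  ext Z
  exact hw.symm _ _

theorem weightFun_eq_zero {w : List ι → List ι → ℝ} (hw : IsListAlt w) {P R Z : Finset ι}
    (h : ¬ Disjoint Z (P ∪ R)) : weightFun w P R Z = 0 := by
  rw [disjoint_union_right, not_and_or] at h
  rcases h with h | h
  · refine hw.eq_zero_of_not_nodup (fun h' => h ?_) _
    rw [Finset.disjoint_left]
    intro x hx hxP
    exact (List.disjoint_of_nodup_append h') (mem_toList.mpr hx) (mem_toList.mpr hxP)
  · refine hw.eq_zero_of_not_nodup' (fun h' => h ?_) _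
    rw [Finset.disjoint_left]
    intro x hx hxP
    exact (List.disjoint_of_nodup_append h') (mem_toList.mpr hx) (mem_toList.mpr hxP)

/-- An `s`-fold contraction prepends the same `s` indices to both lists. Only distinct new indices
survive, and every enlarged set arises from `s!` orderings. -/
theorem iterate_listContr_append {w : List ι → List ι → ℝ} (hw : IsListAlt w) (P R : Finset ι)
    (s : ℕ) : ∀ x : List ι, x.Nodup →
    listContr^[s] w (x ++ P.toList) (x ++ R.toList) =
      s ! * supSum (x.length + s) (weightFun w P R) x.toFinset := by
  induction s with
  | zero =>
    intro x hx
    rw [add_zero, supSum_of_card_eq _ (List.toFinset_card_of_nodup hx), weightFun,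
      Function.iterate_zero, id, Nat.factorial_zero, Nat.cast_one, one_mul]
    exact hw.perm_both (List.toFinset_toList hx).symm _ _
  | succ s ih =>
    intro x hx
    rw [Function.iterate_succ_apply', listContr]
    have hsub : ∑ z ∈ x.toFinsetᶜ, listContr^[s] w (z :: (x ++ P.toList)) (z :: (x ++ R.toList)) =
        ∑ z, listContr^[s] w (z :: (x ++ P.toList)) (z :: (x ++ R.toList)) := by
      refine Finset.sum_subset (subset_univ _) fun z _ hz => ?_
      refine (hw.iterate s).eq_zero_of_not_nodup (fun h => ?_) _
      simp only [mem_compl, List.mem_toFinset, not_not] at hz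
      exact (List.nodup_cons.mp h).1 (List.mem_append_left _ hz)
    have hcard : x.toFinset.card = x.length := List.toFinset_card_of_nodup hx
    calc _ = ∑ z ∈ x.toFinsetᶜ, (s ! : ℝ) *
          supSum (x.length + (s + 1)) (weightFun w P R) (insert z x.toFinset) := by
          rw [← hsub]
          refine Finset.sum_congr rfl fun z hz => ?_
          simp only [mem_compl, List.mem_toFinset] at hz
          rw [← List.cons_append, ← List.cons_append, ih _ (List.nodup_cons.mpr ⟨hz, hx⟩),
            List.toFinset_cons, List.length_cons, show x.length + 1 + s = x.length + (s + 1) by omega]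
      _ = _ := by
          rw [← Finset.mul_sum, sum_supSum_insert, hcard, Nat.factorial_succ]
          rw [show x.length + (s + 1) - x.length = s + 1 by omega]
          push_cast
          ring

/-! ### Sums over tuples -/

theorem sum_injective_image (l : ℕ) (h : Finset ι → ℝ) :
    ∑ i : Fin l → ι with Function.Injective i, h (univ.image i) =
      l ! * ∑ K ∈ powersetCard l univ, h K := by
  have hmaps : ∀ i ∈ ({i : Fin l → ι | Function.Injective i} : Finset _),
      univ.image i ∈ powersetCard l (univ : Finset ι) := by
    intro i hi
    simp only [mem_filter, mem_univ, true_and] at hi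
    rw [mem_powersetCard]
    exact ⟨subset_univ _, by rw [card_image_of_injective _ hi, card_univ, Fintype.card_fin]⟩
  rw [← Finset.sum_fiberwise_of_maps_to hmaps, Finset.mul_sum]
  refine Finset.sum_congr rfl fun K hK => ?_
  have hKc := (mem_powersetCard.mp hK).2
  rw [Finset.sum_congr rfl (g := fun _ => h K) (by
    intro i hi; rw [(mem_filter.mp hi).2]), Finset.sum_const, nsmul_eq_mul]
  congr 2
  rw [filter_filter]
  have e : {i : Fin l → ι // Function.Injective i ∧ univ.image i = K} ≃ (Fin l ↪ K) :=
    { toFun := fun i => ⟨fun q => ⟨i.1 q, by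
          have h := mem_image_of_mem i.1 (mem_univ q)
          rwa [i.2.2] at h⟩, fun q q' hq =>
          i.2.1 (Subtype.ext_iff.mp hq)⟩
      invFun := fun f => ⟨fun q => f q, fun q q' hq => f.injective (Subtype.ext hq), by
        refine eq_of_subset_of_card_le ?_ ?_
        · intro x hx
          obtain ⟨q, -, rfl⟩ := mem_image.mp hx
          exact (f q).2
        · rw [card_image_of_injective _ (fun q q' hq => f.injective (Subtype.ext hq)), hKc]
          simp⟩
      left_inv := fun i => rfl
      right_inv := fun f => rfl }
  rw [← Fintype.card_subtype, Fintype.card_congr e, Fintype.card_embedding_eq]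
  simp [hKc, Nat.descFactorial_self]

/-- By symmetry position `0` may be replaced by any of the `l + 1` positions; summing over all of
them turns `a (i 0)` into the sum of `a` over the image. -/
theorem sum_injective_image_mul (l : ℕ) (a : ι → ℝ) (h : Finset ι → ℝ) :
    ∑ i : Fin (l + 1) → ι with Function.Injective i, a (i 0) * h (univ.image i) =
      l ! * ∑ K ∈ powersetCard (l + 1) univ, (∑ x ∈ K, a x) * h K := by
  have hq (q : Fin (l + 1)) :
      ∑ i : Fin (l + 1) → ι with Function.Injective i, a (i q) * h (univ.image i) =
        ∑ i : Fin (l + 1) → ι with Function.Injective i, a (i 0) * h (univ.image i) := by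
    refine Finset.sum_nbij' (fun i => i ∘ Equiv.swap 0 q) (fun i => i ∘ Equiv.swap 0 q) ?_ ?_ ?_ ?_ ?_
    · intro i hi
      simp only [mem_filter, mem_univ, true_and] at hi ⊢
      exact hi.comp (Equiv.injective _)
    · intro i hi
      simp only [mem_filter, mem_univ, true_and] at hi ⊢
      exact hi.comp (Equiv.injective _)
    · intro i _; ext x; simp
    · intro i _; ext x; simp
    · intro i _
      rw [← Finset.image_image, Finset.image_univ_equiv]
      simp
  have hsum : ((l + 1 : ℕ) : ℝ) *
      ∑ i : Fin (l + 1) → ι with Function.Injective i, a (i 0) * h (univ.image i) =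
      ∑ i : Fin (l + 1) → ι with Function.Injective i,
        (∑ x ∈ univ.image i, a x) * h (univ.image i) := by
    calc _ = ∑ q : Fin (l + 1),
        ∑ i : Fin (l + 1) → ι with Function.Injective i, a (i q) * h (univ.image i) := by
          simp only [hq]; simp
      _ = _ := by
          rw [Finset.sum_comm]
          refine Finset.sum_congr rfl fun i hi => ?_
          simp only [mem_filter, mem_univ, true_and] at hi
          rw [← Finset.sum_mul, Finset.sum_image (fun x _ y _ hxy => hi hxy)]
  rw [sum_injective_image (l + 1) fun K => (∑ x ∈ K, a x) * h K, Nat.factorial_succ] at hsum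
  have : ((l + 1 : ℕ) : ℝ) ≠ 0 := by positivity
  apply mul_left_cancel₀ this
  rw [hsum]
  push_cast
  ring

end Lists

/-! ### The contraction form of a diagonal matrix and its weight decomposition -/

section Diagonal

variable {ι : Type*} [Fintype ι] [DecidableEq ι] {l : ℕ}

theorem energy_diagonal (a : ι → ℝ) (u : Matrix (Fin (l + 1) → ι) (Fin (l + 1) → ι) ℝ) :
    energy (diagonal a) u u = ∑ i, ∑ j, a (i 0) * u i j ^ 2 := by
  rw [energy, firstAct_diagonal, trace]
  simp only [diag_apply, mul_apply (N := u), mul_diagonal, transpose_apply]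
  rw [Finset.sum_comm]
  refine Finset.sum_congr rfl fun i _ => Finset.sum_congr rfl fun j _ => ?_
  ring

/-- The energy at level `l` of a function of two lists. -/
def listEnergy (a : ι → ℝ) (w : List ι → List ι → ℝ) : ℕ → ℝ
  | 0 => 0
  | l + 1 => ∑ i : Fin (l + 1) → ι, ∑ j : Fin (l + 1) → ι,
      a (i 0) * w (List.ofFn i) (List.ofFn j) ^ 2

theorem contrForm_diagonal (a : ι → ℝ) (l r : ℕ) (u : Matrix (Fin l → ι) (Fin l → ι) ℝ) :
    contrForm (diagonal a) l r u u = ∑ s ∈ range l, (((r + s)! * (l - s)! : ℕ) : ℝ)⁻¹ *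
      listEnergy a (listContr^[s] (toLists u)) (l - s) := by
  induction l generalizing r with
  | zero => simp [contrForm]
  | succ l ih =>
    rw [contrForm, ih, Finset.sum_range_succ', add_comm, energy_diagonal]
    congr 1
    · refine Finset.sum_congr rfl fun s _ => ?_
      rw [toLists_contr, Function.iterate_succ_apply, show r + 1 + s = r + (s + 1) by omega,
        show l + 1 - (s + 1) = l - s by omega]
    · simp only [Function.iterate_zero, id, Nat.sub_zero, add_zero, listEnergy, toLists_ofFn]

theorem List.toFinset_ofFn_eq_image (i : Fin l → ι) : (List.ofFn i).toFinset = univ.image i := by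
  ext x
  simp [List.mem_ofFn, eq_comm]

/-- The square of an alternating function of two lists, as a function of two sets. -/
noncomputable def setSq (w : List ι → List ι → ℝ) (K L : Finset ι) : ℝ :=
  w ((K ∩ L).toList ++ (K \ L).toList) ((K ∩ L).toList ++ (L \ K).toList) ^ 2

theorem toList_append_perm {K : Finset ι} {x : List ι} (hx : x.Nodup) (hK : x.toFinset = K)
    {J P : Finset ι} (hd : Disjoint J P) (hJ : J ∪ P = K) :
    x.Perm (J.toList ++ P.toList) := by
  refine (List.perm_ext_iff_of_nodup hx ?_).mpr fun y => ?_
  · rw [List.nodup_append]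
    refine ⟨nodup_toList _, nodup_toList _, fun y hy z hz hyz => ?_⟩
    subst hyz
    exact Finset.disjoint_left.mp hd (mem_toList.mp hy) (mem_toList.mp hz)
  · rw [← List.mem_toFinset, hK, ← hJ]
    simp

theorem IsListAlt.sq_ofFn {w : List ι → List ι → ℝ} (hw : IsListAlt w) {i j : Fin l → ι}
    (hi : Function.Injective i) (hj : Function.Injective j) :
    w (List.ofFn i) (List.ofFn j) ^ 2 = setSq w (univ.image i) (univ.image j) := by
  refine hw.sq_perm₂ (toList_append_perm (List.nodup_ofFn.mpr hi) (List.toFinset_ofFn_eq_image i)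
    (disjoint_sdiff_inter _ _).symm (by rw [union_comm, sdiff_union_inter])) (toList_append_perm
    (List.nodup_ofFn.mpr hj) (List.toFinset_ofFn_eq_image j) ?_ ?_)
  · rw [inter_comm]; exact (disjoint_sdiff_inter _ _).symm
  · rw [inter_comm, union_comm, sdiff_union_inter]

theorem listEnergy_eq (a : ι → ℝ) {w : List ι → List ι → ℝ} (hw : IsListAlt w) (l : ℕ) :
    listEnergy a w l = (((l - 1)! * l ! : ℕ) : ℝ) *
      ∑ K ∈ powersetCard l univ, ∑ L ∈ powersetCard l univ, (∑ x ∈ K, a x) * setSq w K L := by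
  cases l with
  | zero => simp [listEnergy]
  | succ l =>
    have h1 : ∀ i : Fin (l + 1) → ι,
        ∑ j : Fin (l + 1) → ι, a (i 0) * w (List.ofFn i) (List.ofFn j) ^ 2 =
          if Function.Injective i then a (i 0) * ((l + 1)! *
            ∑ L ∈ powersetCard (l + 1) univ, setSq w (univ.image i) L) else 0 := by
      intro i
      split_ifs with hi
      · rw [← sum_injective_image, Finset.sum_filter, Finset.mul_sum]
        refine Finset.sum_congr rfl fun j _ => ?_
        split_ifs with hj
        · rw [hw.sq_ofFn hi hj]
        · rw [hw.eq_zero_of_not_nodup' (by rwa [List.nodup_ofFn])]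
          simp
      · refine Finset.sum_eq_zero fun j _ => ?_
        rw [hw.eq_zero_of_not_nodup (by rwa [List.nodup_ofFn])]
        simp
    rw [listEnergy]
    simp only [h1]
    rw [← Finset.sum_filter, sum_injective_image_mul l a fun K =>
      ((l + 1)! * ∑ L ∈ powersetCard (l + 1) univ, setSq w K L)]
    simp only [Finset.mul_sum, Nat.add_sub_cancel]
    refine Finset.sum_congr rfl fun K _ => Finset.sum_congr rfl fun L _ => ?_
    push_cast
    ring

theorem setSq_iterate {w : List ι → List ι → ℝ} (hw : IsListAlt w) (s : ℕ) (K L : Finset ι) :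
    setSq (listContr^[s] w) K L =
      (s ! * supSum ((K ∩ L).card + s) (weightFun w (K \ L) (L \ K)) (K ∩ L)) ^ 2 := by
  rw [setSq, iterate_listContr_append hw _ _ _ _ (nodup_toList _), length_toList, toList_toFinset]

/-- The summand of the contraction form belonging to a pair of sets of equal size. -/
noncomputable def pairTerm (m : ℕ) (w : List ι → List ι → ℝ) (K L : Finset ι) : ℝ :=
  (((K.card - 1)! * (m - K.card)! : ℕ) : ℝ) *
    supSum (m - (K \ L).card) (weightFun w (K \ L) (L \ K)) (K ∩ L) ^ 2

theorem pairTerm_comm {w : List ι → List ι → ℝ} (hw : IsListAlt w) (m : ℕ)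
    {K L : Finset ι} (h : K.card = L.card) : pairTerm m w K L = pairTerm m w L K := by
  rw [pairTerm, pairTerm, weightFun_comm hw, inter_comm, h, card_sdiff_comm h]

/-- At level `l = m - s`, squaring the contraction gives `s! ^ 2`, counting tuples gives `(l - 1)!
l!`, and the weight divides by `s! l!`. What remains is the factor `(l - 1)! (m - l)!` of
`pairTerm`. -/
theorem contrForm_diagonal_eq_sum (a : ι → ℝ) {m : ℕ} {u : Matrix (Fin m → ι) (Fin m → ι) ℝ}
    (hu : IsAltSymm u) :
    contrForm (diagonal a) m 0 u u = ∑ l ∈ range (m + 1), ∑ K ∈ powersetCard l univ,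
      ∑ L ∈ powersetCard l univ, (∑ x ∈ K, a x) * pairTerm m (toLists u) K L := by
  rw [contrForm_diagonal, ← Finset.sum_range_reflect, Finset.sum_range_succ']
  have h0 : ∑ K ∈ powersetCard 0 (univ : Finset ι), ∑ L ∈ powersetCard 0 univ,
      (∑ x ∈ K, a x) * pairTerm m (toLists u) K L = 0 := by simp
  rw [h0, add_zero]
  refine Finset.sum_congr rfl fun t ht => ?_
  have ht := mem_range.mp ht
  rw [show m - (m - 1 - t) = t + 1 by omega, listEnergy_eq a (hu.isListAlt.iterate _), zero_add,
    Finset.mul_sum, Finset.mul_sum]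
  refine Finset.sum_congr rfl fun K hK => ?_
  rw [Finset.mul_sum, Finset.mul_sum]
  refine Finset.sum_congr rfl fun L hL => ?_
  have hKc := (mem_powersetCard.mp hK).2
  have hcard := card_sdiff_add_card_inter K L
  rw [setSq_iterate hu.isListAlt, pairTerm, hKc,
    show (K ∩ L).card + (m - 1 - t) = m - (K \ L).card by omega,
    show m - (t + 1) = m - 1 - t by omega]
  have : ((t + 1)! : ℝ) ≠ 0 := by positivity
  have : ((m - 1 - t)! : ℝ) ≠ 0 := by positivity
  push_cast
  field_simp

/-- A pair `(K, L)` is the same as the weight `(K \ L, L \ K)` together with `K ∩ L`, and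
contraction preserves the weight. Symmetry in `K` and `L` replaces the coefficient `a(K)` by the
mean of `a(K)` and `a(L)`. -/
theorem contrForm_diagonal_eq_sum_block (a : ι → ℝ) {m : ℕ}
    {u : Matrix (Fin m → ι) (Fin m → ι) ℝ} (hu : IsAltSymm u) :
    contrForm (diagonal a) m 0 u u =
      ∑ c : Finset ι × Finset ι with Disjoint c.1 c.2 ∧ c.1.card = c.2.card ∧ c.1.card ≤ m,
        blockForm c.1 c.2 (m - c.1.card) a (weightFun (toLists u) c.1 c.2) := by
  have hw := hu.isListAlt
  rw [contrForm_diagonal_eq_sum a hu]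
  have h1 : ∀ l, ∑ K ∈ powersetCard l univ, ∑ L ∈ powersetCard l univ,
      (∑ x ∈ K, a x) * pairTerm m (toLists u) K L =
      ∑ c ∈ powersetCard l (univ : Finset ι) ×ˢ powersetCard l univ,
        ((∑ x ∈ c.1, a x + ∑ x ∈ c.2, a x) / 2) * pairTerm m (toLists u) c.1 c.2 := by
    intro l
    rw [Finset.sum_product]
    have hswap : ∑ K ∈ powersetCard l univ, ∑ L ∈ powersetCard l univ,
        (∑ x ∈ K, a x) * pairTerm m (toLists u) K L =
        ∑ K ∈ powersetCard l univ, ∑ L ∈ powersetCard l univ,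
        (∑ x ∈ L, a x) * pairTerm m (toLists u) K L := by
      rw [Finset.sum_comm]
      refine Finset.sum_congr rfl fun K hK => Finset.sum_congr rfl fun L hL => ?_
      rw [pairTerm_comm hw]
      rw [(mem_powersetCard.mp hK).2, (mem_powersetCard.mp hL).2]
    calc _ = (∑ K ∈ powersetCard l univ, ∑ L ∈ powersetCard l univ,
        (∑ x ∈ K, a x) * pairTerm m (toLists u) K L +
        ∑ K ∈ powersetCard l univ, ∑ L ∈ powersetCard l univ,
        (∑ x ∈ L, a x) * pairTerm m (toLists u) K L) / 2 := by rw [← hswap]; ring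
      _ = _ := by
        rw [← Finset.sum_add_distrib, Finset.sum_div]
        refine Finset.sum_congr rfl fun K _ => ?_
        rw [← Finset.sum_add_distrib, Finset.sum_div]
        refine Finset.sum_congr rfl fun L _ => ?_
        ring
  simp only [h1]
  -- Sets `J` too large for level `m` have no superset of the required size and contribute zero, so
  -- they may be dropped.
  have h2 : ∀ c : Finset ι × Finset ι, c.1.card ≤ m →
      blockForm c.1 c.2 (m - c.1.card) a (weightFun (toLists u) c.1 c.2) =
      ∑ J ∈ (c.1 ∪ c.2)ᶜ.powerset with c.1.card + J.card ≤ m,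
        (((c.1.card + J.card - 1)! * (m - c.1.card - J.card)! : ℕ) : ℝ) *
        ((∑ i ∈ c.1, a i + ∑ i ∈ c.2, a i) / 2 + ∑ i ∈ J, a i) *
        supSum (m - c.1.card) (weightFun (toLists u) c.1 c.2) J ^ 2 := by
    intro c hc
    rw [blockForm, Finset.sum_filter]
    refine Finset.sum_congr rfl fun J _ => ?_
    split_ifs with h
    · rfl
    · rw [supSum_of_card_lt _ (by omega)]
      simp
  rw [Finset.sum_congr rfl fun c hc => h2 c (mem_filter.mp hc).2.2.2, Finset.sum_sigma',
    Finset.sum_sigma']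
  refine Finset.sum_bij' (fun c _ => ⟨(c.2.1 \ c.2.2, c.2.2 \ c.2.1), c.2.1 ∩ c.2.2⟩)
    (fun c _ => ⟨c.1.1.card + c.2.card, (c.1.1 ∪ c.2, c.1.2 ∪ c.2)⟩) ?_ ?_ ?_ ?_ ?_
  · rintro ⟨l, K, L⟩ hc
    simp only [mem_sigma, mem_range, mem_product, mem_powersetCard, subset_univ, true_and] at hc
    obtain ⟨hl, hK, hL⟩ := hc
    have hcard := card_sdiff_add_card_inter K L
    simp only [mem_sigma, mem_filter, mem_univ, true_and, mem_powerset]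
    refine ⟨⟨disjoint_sdiff_sdiff, card_sdiff_comm (hK.trans hL.symm), by omega⟩, ?_, by omega⟩
    intro x
    simp only [mem_inter, mem_compl, mem_union, mem_sdiff]
    tauto
  · rintro ⟨⟨P, R⟩, J⟩ hc
    simp only [mem_sigma, mem_filter, mem_univ, true_and, mem_powerset] at hc
    obtain ⟨⟨hd, hPR, hP⟩, hJ, hm⟩ := hc
    have hJ' : Disjoint J (P ∪ R) := by rwa [← subset_compl_iff_disjoint_right]
    rw [disjoint_union_right] at hJ'
    simp only [mem_sigma, mem_range, mem_product, mem_powersetCard, subset_univ, true_and]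
    refine ⟨by omega, ?_, ?_⟩
    · rw [card_union_of_disjoint hJ'.1.symm]
    · rw [card_union_of_disjoint hJ'.2.symm, hPR]
  · rintro ⟨l, K, L⟩ hc
    simp only [mem_sigma, mem_range, mem_product, mem_powersetCard, subset_univ, true_and] at hc
    obtain ⟨hl, hK, hL⟩ := hc
    simp only [card_sdiff_add_card_inter, sdiff_union_inter, hK]
    rw [inter_comm, sdiff_union_inter]
  · rintro ⟨⟨P, R⟩, J⟩ hc
    simp only [mem_sigma, mem_filter, mem_univ, true_and, mem_powerset] at hc
    obtain ⟨⟨hd, hPR, hP⟩, hJ, hm⟩ := hc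
    have hJ' : Disjoint J (P ∪ R) := by rwa [← subset_compl_iff_disjoint_right]
    rw [disjoint_union_right] at hJ'
    have e1 : (P ∪ J) \ (R ∪ J) = P := by
      ext x
      simp only [mem_sdiff, mem_union]
      have h3 : x ∈ P → x ∉ R := fun h => Finset.disjoint_left.mp hd h
      have h4 : x ∈ J → x ∉ P := fun h => Finset.disjoint_left.mp hJ'.1 h
      tauto
    have e2 : (R ∪ J) \ (P ∪ J) = R := by
      ext x
      simp only [mem_sdiff, mem_union]
      have h3 : x ∈ P → x ∉ R := fun h => Finset.disjoint_left.mp hd h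
      have h4 : x ∈ J → x ∉ R := fun h => Finset.disjoint_left.mp hJ'.2 h
      tauto
    have e3 : (P ∪ J) ∩ (R ∪ J) = J := by
      ext x
      simp only [mem_inter, mem_union]
      have h3 : x ∈ P → x ∉ R := fun h => Finset.disjoint_left.mp hd h
      tauto
    simp only [e1, e2, e3]
  · rintro ⟨l, K, L⟩ hc
    simp only [mem_sigma, mem_range, mem_product, mem_powersetCard, subset_univ, true_and] at hc
    obtain ⟨hl, hK, hL⟩ := hc
    have hcard := card_sdiff_add_card_inter K L
    simp only [pairTerm]
    rw [hcard, show m - (K \ L).card - (K ∩ L).card = m - K.card by omega]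
    have s1 : ∑ x ∈ K, a x = ∑ x ∈ K \ L, a x + ∑ x ∈ K ∩ L, a x := by
      rw [← Finset.sum_union (disjoint_sdiff_inter _ _), sdiff_union_inter]
    have s2 : ∑ x ∈ L, a x = ∑ x ∈ L \ K, a x + ∑ x ∈ K ∩ L, a x := by
      rw [inter_comm, ← Finset.sum_union (disjoint_sdiff_inter _ _), sdiff_union_inter]
    rw [s1, s2]
    ring

theorem contrForm_diagonal_nonneg {a : ι → ℝ} {m : ℕ} (h : ∀ f, 0 ≤ boolForm m a f)
    {u : Matrix (Fin m → ι) (Fin m → ι) ℝ} (hu : IsAltSymm u) :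
    0 ≤ contrForm (diagonal a) m 0 u u := by
  rw [contrForm_diagonal_eq_sum_block a hu]
  refine Finset.sum_nonneg fun c hc => ?_
  simp only [mem_filter, mem_univ, true_and] at hc
  refine blockForm_nonneg c.1.card hc.1 rfl hc.2.1.symm _ _
    (fun S hS => weightFun_eq_zero hu.isListAlt hS) ?_
  rwa [Nat.sub_add_cancel hc.2.2]

end Diagonal

/-! ### Diagonal tensors and their faces -/

section DeltaDet

variable {ι : Type*} [Fintype ι] [DecidableEq ι] {l : ℕ}

/-- The generalized Kronecker delta. -/
def deltaDet (i j : Fin l → ι) : ℝ := det (of fun p q => if i p = j q then (1 : ℝ) else 0)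

theorem deltaDet_comm (i j : Fin l → ι) : deltaDet i j = deltaDet j i := by
  rw [deltaDet, ← det_transpose, deltaDet]
  congr 1
  ext p q
  simp [eq_comm]

theorem deltaDet_comp_left (σ : Equiv.Perm (Fin l)) (i j : Fin l → ι) :
    deltaDet (i ∘ σ) j = (Equiv.Perm.sign σ : ℤ) * deltaDet i j := by
  rw [deltaDet, deltaDet, ← det_permute]
  rfl

theorem deltaDet_comp_right (σ : Equiv.Perm (Fin l)) (i j : Fin l → ι) :
    deltaDet i (j ∘ σ) = (Equiv.Perm.sign σ : ℤ) * deltaDet i j := by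
  rw [deltaDet_comm, deltaDet_comp_left, deltaDet_comm]

theorem deltaDet_eq_sum (i j : Fin l → ι) :
    deltaDet i j = ∑ σ : Equiv.Perm (Fin l),
      (Equiv.Perm.sign σ : ℤ) * (if i ∘ σ = j then (1 : ℝ) else 0) := by
  rw [deltaDet, det_apply']
  refine Finset.sum_congr rfl fun σ _ => ?_
  congr 1
  simp only [of_apply]
  split_ifs with h
  · exact Finset.prod_eq_one fun q _ => if_pos (congrFun h q)
  · obtain ⟨q, hq⟩ := Function.ne_iff.mp h
    exact Finset.prod_eq_zero (Finset.mem_univ q) (if_neg hq)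

theorem image_eq_of_deltaDet_ne_zero {i j : Fin l → ι} (h : deltaDet i j ≠ 0) :
    univ.image i = univ.image j := by
  rw [deltaDet_eq_sum] at h
  obtain ⟨σ, -, hσ⟩ := Finset.exists_ne_zero_of_sum_ne_zero h
  have : i ∘ σ = j := by
    by_contra h'
    simp [h'] at hσ
  rw [← this, ← Finset.image_image, Finset.image_univ_equiv]

theorem deltaDet_eq_zero_of_not_injective {i : Fin l → ι} (h : ¬ Function.Injective i)
    (j : Fin l → ι) : deltaDet i j = 0 := by
  obtain ⟨p, q, hpq, hne⟩ := Function.not_injective_iff.mp h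
  exact det_zero_of_row_eq hne (by ext x; simp [hpq])

theorem deltaDet_self {i : Fin l → ι} (h : Function.Injective i) : deltaDet i i = 1 := by
  rw [deltaDet, ← det_one (n := Fin l)]
  congr 1
  ext p q
  simp [one_apply, h.eq_iff]

/-- After expanding the second factor over permutations, each of the `l!` terms contributes
`deltaDet x y`, because its sign occurs squared. -/
theorem sum_deltaDet_mul (x y : Fin l → ι) :
    ∑ j, deltaDet x j * deltaDet y j = l ! * deltaDet x y := by
  have : ∀ j, deltaDet x j * deltaDet y j = ∑ σ : Equiv.Perm (Fin l),
      if y ∘ σ = j then (Equiv.Perm.sign σ : ℤ) * deltaDet x j else 0 := by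
    intro j
    rw [deltaDet_eq_sum y, Finset.mul_sum]
    refine Finset.sum_congr rfl fun σ _ => ?_
    split_ifs <;> ring
  simp only [this]
  rw [Finset.sum_comm]
  have h2 : ∀ σ : Equiv.Perm (Fin l), ∑ j, (if y ∘ σ = j then
      ((Equiv.Perm.sign σ : ℤ) : ℝ) * deltaDet x j else 0) = deltaDet x y := by
    intro σ
    rw [Finset.sum_ite_eq, if_pos (mem_univ _), deltaDet_comp_right, ← mul_assoc]
    rcases Int.units_eq_one_or (Equiv.Perm.sign σ) with h | h <;> simp [h]
  simp only [h2, Finset.sum_const, card_univ, Fintype.card_perm, Fintype.card_fin, nsmul_eq_mul]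

/-- Laplace expansion along the first column. The right side is the boundary of the simplex `x`,
tested against `j`. -/
theorem sum_deltaDet_cons (x : Fin (l + 1) → ι) (j : Fin l → ι) :
    ∑ w, deltaDet x (Fin.cons w j) =
      ∑ q : Fin (l + 1), (-1) ^ (q : ℕ) * deltaDet (x ∘ q.succAbove) j := by
  have : ∀ w, deltaDet x (Fin.cons w j) = ∑ q : Fin (l + 1),
      if x q = w then (-1) ^ (q : ℕ) * deltaDet (x ∘ q.succAbove) j else 0 := by
    intro w
    rw [deltaDet, det_succ_column_zero]
    refine Finset.sum_congr rfl fun q _ => ?_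
    simp only [of_apply, Fin.cons_zero]
    split_ifs with h
    · rw [mul_one]
      rfl
    · ring
  simp only [this]
  rw [Finset.sum_comm]
  simp

theorem univ_image_cons (z : ι) (i : Fin l → ι) :
    univ.image (Fin.cons z i : Fin (l + 1) → ι) = insert z (univ.image i) := by
  ext x
  simp [Fin.exists_fin_succ, eq_comm]

theorem Fin.cons_injective_of_notMem {z : ι} {i : Fin l → ι} (hi : Function.Injective i)
    (hz : z ∉ univ.image i) : Function.Injective (Fin.cons z i : Fin (l + 1) → ι) := by
  rw [Fin.cons_injective_iff]
  exact ⟨by simpa using hz, hi⟩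

theorem deltaDet_cons_cons (z : ι) (i j : Fin l → ι) :
    deltaDet (Fin.cons z i : Fin (l + 1) → ι) (Fin.cons z j) =
      if z ∈ univ.image i then 0 else deltaDet i j := by
  split_ifs with h
  · refine deltaDet_eq_zero_of_not_injective (fun h' => ?_) _
    rw [Fin.cons_injective_iff] at h'
    exact h'.1 (by simpa using h)
  · rw [deltaDet, det_succ_row_zero, Finset.sum_eq_single_of_mem 0 (mem_univ _)]
    · simp only [Fin.val_zero, pow_zero, one_mul, of_apply, Fin.cons_zero, if_true]
      rfl
    · intro q _ hq
      obtain ⟨p, rfl⟩ := Fin.exists_succ_eq.mpr hq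
      -- If `z = j p`, the minor still contains the column of the leading `z`, which vanishes
      -- because `z` is not among the entries of `i`; otherwise the coefficient of the minor is
      -- zero.
      by_cases hp : z = j p
      · have : det ((of fun p q => if (Fin.cons z i : Fin (l + 1) → ι) p =
            (Fin.cons z j : Fin (l + 1) → ι) q then (1 : ℝ) else 0).submatrix Fin.succ
            (p.succ).succAbove) = 0 := by
          rcases l with _ | l
          · exact p.elim0
          refine det_eq_zero_of_column_eq_zero 0 fun r => ?_
          simp only [submatrix_apply, of_apply, Fin.cons_succ]
          rw [Fin.succAbove_ne_zero_zero (Fin.succ_ne_zero p), Fin.cons_zero, if_neg]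
          rintro rfl
          exact h (by simp)
        rw [this, mul_zero]
      · simp [hp]

/-- The diagonal tensor with diagonal entries given by a set function. -/
def diagTensor (l : ℕ) (g : Finset ι → ℝ) : Matrix (Fin l → ι) (Fin l → ι) ℝ :=
  of fun i j => g (univ.image i) * deltaDet i j

theorem diagTensor_apply (g : Finset ι → ℝ) (i j : Fin l → ι) :
    diagTensor l g i j = g (univ.image i) * deltaDet i j := rfl

theorem diagTensor_isAltSymm (g : Finset ι → ℝ) : IsAltSymm (diagTensor l g) where
  perm σ i j := by
    rw [diagTensor_apply, diagTensor_apply, deltaDet_comp_left, ← Finset.image_image,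
      Finset.image_univ_equiv]
    ring
  symm i j := by
    rw [diagTensor_apply, diagTensor_apply, deltaDet_comm j i]
    by_cases h : deltaDet i j = 0
    · simp [h]
    · rw [image_eq_of_deltaDet_ne_zero h]

theorem diagTensor_congr {g g' : Finset ι → ℝ} (h : ∀ L, L.card = l → g L = g' L) :
    diagTensor l g = diagTensor l g' := by
  ext i j
  rw [diagTensor_apply, diagTensor_apply]
  by_cases hi : Function.Injective i
  · rw [h]
    rw [card_image_of_injective _ hi, card_univ, Fintype.card_fin]
  · simp [deltaDet_eq_zero_of_not_injective hi]

/-- The sum of `g` over the sets obtained by adding one element. -/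
def upSum (g : Finset ι → ℝ) (L : Finset ι) : ℝ := ∑ z ∈ Lᶜ, g (insert z L)

theorem contr_diagTensor (g : Finset ι → ℝ) :
    contr (diagTensor (l + 1) g) = diagTensor l (upSum g) := by
  ext i j
  rw [contr_apply, diagTensor_apply, upSum, Finset.sum_mul]
  symm
  rw [← Finset.sum_subset (subset_univ (univ.image i)ᶜ)]
  · refine Finset.sum_congr rfl fun z hz => ?_
    rw [diagTensor_apply, univ_image_cons, deltaDet_cons_cons, if_neg (mem_compl.mp hz)]
  · intro z _ hz
    rw [diagTensor_apply, deltaDet_cons_cons, if_pos (by simpa using hz), mul_zero]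

/-- The contraction of the first row index and of the first column index of a diagonal tensor
with the all-ones vector. -/
def faceTensor (l : ℕ) (g : Finset ι → ℝ) : Matrix (Fin l → ι) (Fin l → ι) ℝ :=
  of fun i j => ∑ z, ∑ w, diagTensor (l + 1) g (Fin.cons z i) (Fin.cons w j)

theorem faceTensor_apply (g : Finset ι → ℝ) (i j : Fin l → ι) :
    faceTensor l g i j = ∑ z, ∑ w, diagTensor (l + 1) g (Fin.cons z i) (Fin.cons w j) := rfl

theorem exists_perm_cons (σ : Equiv.Perm (Fin l)) : ∃ τ : Equiv.Perm (Fin (l + 1)),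
    Equiv.Perm.sign τ = Equiv.Perm.sign σ ∧ ∀ (z : ι) (i : Fin l → ι),
      (Fin.cons z (i ∘ σ) : Fin (l + 1) → ι) = (Fin.cons z i : Fin (l + 1) → ι) ∘ τ := by
  refine ⟨Equiv.Perm.decomposeFin.symm (0, σ), by simp, fun z i => ?_⟩
  ext q
  refine Fin.cases ?_ (fun q => ?_) q
  · simp
  · simp

theorem faceTensor_isAltSymm (g : Finset ι → ℝ) : IsAltSymm (faceTensor l g) where
  perm σ i j := by
    obtain ⟨τ, hτ, h⟩ := exists_perm_cons (ι := ι) σ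
    simp only [faceTensor_apply, h, (diagTensor_isAltSymm g).perm, hτ, Finset.mul_sum]
  symm i j := by
    rw [faceTensor_apply, faceTensor_apply, Finset.sum_comm]
    exact Finset.sum_congr rfl fun z _ => Finset.sum_congr rfl fun w _ =>
      (diagTensor_isAltSymm g).symm _ _

theorem cons_cons_comp_swap (y z : ι) (i : Fin l → ι) :
    (Fin.cons y (Fin.cons z i : Fin (l + 1) → ι) : Fin (l + 2) → ι) ∘ Equiv.swap 0 1 =
      Fin.cons z (Fin.cons y i : Fin (l + 1) → ι) := by
  ext q
  refine Fin.cases ?_ (fun q => Fin.cases ?_ (fun q => ?_) q) q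
  · rw [Function.comp, Equiv.swap_apply_left]
    rfl
  · simp
  · rw [Function.comp, Equiv.swap_apply_of_ne_of_ne (Fin.succ_ne_zero _)]
    · simp
    · rw [← Fin.succ_zero_eq_one, Ne, Fin.succ_inj]
      exact Fin.succ_ne_zero _

/-- Exchanging the first two slots in rows and in columns costs two cancelling signs, so the two
operations commute. -/
theorem contr_faceTensor (g : Finset ι → ℝ) :
    contr (faceTensor (l + 1) g) = faceTensor l (upSum g) := by
  ext i j
  rw [contr_apply, faceTensor_apply, ← contr_diagTensor]
  simp only [faceTensor_apply, contr_apply]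
  rw [Finset.sum_comm]
  refine Finset.sum_congr rfl fun z _ => ?_
  rw [Finset.sum_comm]
  refine Finset.sum_congr rfl fun w _ => Finset.sum_congr rfl fun y _ => ?_
  rw [← cons_cons_comp_swap y z, ← cons_cons_comp_swap y w, (diagTensor_isAltSymm g).perm,
    (diagTensor_isAltSymm g).perm_right, Equiv.Perm.sign_swap Fin.zero_ne_one]
  simp

theorem faceTensor_congr {g g' : Finset ι → ℝ} (h : ∀ L, L.card = l + 1 → g L = g' L) :
    faceTensor l g = faceTensor l g' := by
  rw [faceTensor, faceTensor, diagTensor_congr h]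

/-- The contraction of the first row index of a face tensor with the all-ones vector vanishes. -/
theorem sum_faceTensor_cons (g : Finset ι → ℝ) (i : Fin l → ι) (j : Fin (l + 1) → ι) :
    ∑ y, faceTensor (l + 1) g (Fin.cons y i) j = 0 := by
  simp only [faceTensor_apply]
  have key : ∑ y, ∑ z, ∑ w, diagTensor (l + 2) g (Fin.cons z (Fin.cons y i : Fin (l + 1) → ι))
      (Fin.cons w j) = -∑ y, ∑ z, ∑ w, diagTensor (l + 2) g
      (Fin.cons z (Fin.cons y i : Fin (l + 1) → ι)) (Fin.cons w j) := by
    nth_rewrite 1 [Finset.sum_comm]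
    simp only [← Finset.sum_neg_distrib]
    refine Finset.sum_congr rfl fun z _ => Finset.sum_congr rfl fun y _ =>
      Finset.sum_congr rfl fun w _ => ?_
    rw [← cons_cons_comp_swap z y, (diagTensor_isAltSymm g).perm,
      Equiv.Perm.sign_swap Fin.zero_ne_one]
    simp
  linarith

/-- An inner product of boundaries of two simplices sharing the face `i`. Equal simplices have `l +
1` common faces, each pairing to one; different ones share only `i`, with sign one. -/
theorem sum_face_mul_face {i : Fin l → ι} (hi : Function.Injective i) {z z' : ι}
    (hz : z ∉ univ.image i) (hz' : z' ∉ univ.image i) :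
    ∑ j, (∑ w, deltaDet (Fin.cons z i : Fin (l + 1) → ι) (Fin.cons w j)) *
      (∑ w, deltaDet (Fin.cons z' i : Fin (l + 1) → ι) (Fin.cons w j)) =
      l ! * ((if z = z' then (l : ℝ) else 0) + 1) := by
  have h1 : ∀ x x' : Fin (l + 1) → ι, ∑ j, (∑ w, deltaDet x (Fin.cons w j)) *
      (∑ w, deltaDet x' (Fin.cons w j)) = l ! * ∑ q : Fin (l + 1), ∑ q' : Fin (l + 1),
        (-1) ^ (q : ℕ) * (-1) ^ (q' : ℕ) *
          deltaDet (x ∘ q.succAbove) (x' ∘ q'.succAbove) := by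
    intro x x'
    simp only [sum_deltaDet_cons, Finset.sum_mul_sum]
    rw [Finset.sum_comm, Finset.mul_sum]
    refine Finset.sum_congr rfl fun q _ => ?_
    rw [Finset.sum_comm, Finset.mul_sum]
    refine Finset.sum_congr rfl fun q' _ => ?_
    rw [← mul_left_comm, ← sum_deltaDet_mul, Finset.mul_sum]
    refine Finset.sum_congr rfl fun j _ => ?_
    ring
  rw [h1]
  congr 1
  have hx := Fin.cons_injective_of_notMem hi hz
  by_cases hzz : z = z'
  · subst hzz
    set x : Fin (l + 1) → ι := Fin.cons z i
    have h2 : ∀ q q' : Fin (l + 1), (-1) ^ (q : ℕ) * (-1) ^ (q' : ℕ) *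
          deltaDet (x ∘ q.succAbove) (x ∘ q'.succAbove) = if q = q' then 1 else 0 := by
      intro q q'
      split_ifs with h
      · subst h
        rw [deltaDet_self (hx.comp Fin.succAbove_right_injective), ← mul_pow]
        simp
      · by_contra hne
        have hd := image_eq_of_deltaDet_ne_zero (right_ne_zero_of_mul (fun h0 => hne h0))
        have hm : x q' ∈ univ.image (x ∘ q.succAbove) := by
          obtain ⟨p, hp⟩ := Fin.exists_succAbove_eq (Ne.symm h)
          exact mem_image.mpr ⟨p, mem_univ _, by rw [Function.comp, hp]⟩
        rw [hd] at hm
        obtain ⟨p, -, hp⟩ := mem_image.mp hm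
        exact Fin.succAbove_ne q' p (hx hp)
    simp [h2]
  · rw [if_neg hzz, zero_add, Finset.sum_eq_single_of_mem 0 (mem_univ _),
      Finset.sum_eq_single_of_mem 0 (mem_univ _)]
    · have : ∀ y : ι, (Fin.cons y i : Fin (l + 1) → ι) ∘ (0 : Fin (l + 1)).succAbove = i := by
        intro y; ext q; simp
      rw [this, this, deltaDet_self hi]
      simp
    · intro q' _ hq'
      by_contra hne
      have hd := image_eq_of_deltaDet_ne_zero (right_ne_zero_of_mul (fun h0 => hne h0))
      have hm : z' ∈ univ.image ((Fin.cons z' i : Fin (l + 1) → ι) ∘ q'.succAbove) := by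
        obtain ⟨p, hp⟩ := Fin.exists_succAbove_eq (Ne.symm hq')
        exact mem_image.mpr ⟨p, mem_univ _, by rw [Function.comp, hp]; rfl⟩
      rw [← hd] at hm
      obtain ⟨p, -, hp⟩ := mem_image.mp hm
      simp only [Function.comp, Fin.zero_succAbove, Fin.cons_succ] at hp
      exact hz' (mem_image.mpr ⟨p, mem_univ _, hp⟩)
    · intro q _ hq
      refine Finset.sum_eq_zero fun q' _ => ?_
      by_contra hne
      have hd := image_eq_of_deltaDet_ne_zero (right_ne_zero_of_mul (fun h0 => hne h0))
      have hm : z ∈ univ.image ((Fin.cons z i : Fin (l + 1) → ι) ∘ q.succAbove) := by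
        obtain ⟨p, hp⟩ := Fin.exists_succAbove_eq (Ne.symm hq)
        exact mem_image.mpr ⟨p, mem_univ _, by rw [Function.comp, hp]; rfl⟩
      rw [hd] at hm
      obtain ⟨p, -, hp⟩ := mem_image.mp hm
      simp only [Function.comp] at hp
      have : z ∈ univ.image (Fin.cons z' i : Fin (l + 1) → ι) := by
        rw [← hp]; exact mem_image_of_mem _ (mem_univ _)
      rw [univ_image_cons, mem_insert] at this
      exact this.elim hzz hz

/-- The Gram matrix of the boundaries is `l!` times the all-ones matrix plus `l` times the identity.
These two parts give the square of `upSum` and the sum of squares. -/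
theorem sum_faceTensor_sq (g : Finset ι → ℝ) (i : Fin l → ι) :
    ∑ j, faceTensor l g i j ^ 2 = if Function.Injective i then
      l ! * (upSum g (univ.image i) ^ 2 +
        l * ∑ z ∈ (univ.image i)ᶜ, g (insert z (univ.image i)) ^ 2) else 0 := by
  split_ifs with hi
  · have h1 : ∀ j, faceTensor l g i j = ∑ z ∈ (univ.image i)ᶜ, g (insert z (univ.image i)) *
        ∑ w, deltaDet (Fin.cons z i : Fin (l + 1) → ι) (Fin.cons w j) := by
      intro j
      rw [faceTensor_apply]
      symm
      rw [← Finset.sum_subset (subset_univ (univ.image i)ᶜ)]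
      · refine Finset.sum_congr rfl fun z _ => ?_
        simp only [diagTensor_apply, univ_image_cons, Finset.mul_sum]
      · intro z _ hz
        refine Finset.sum_eq_zero fun w _ => ?_
        rw [diagTensor_apply, deltaDet_eq_zero_of_not_injective, mul_zero]
        rw [Fin.cons_injective_iff]
        simp only [mem_compl, mem_image, mem_univ, true_and, not_not] at hz
        exact fun h => h.1 (by simpa using hz)
    simp only [h1, pow_two, Finset.sum_mul_sum]
    rw [Finset.sum_comm]
    have h2 : ∀ z ∈ (univ.image i)ᶜ, ∑ j, ∑ z' ∈ (univ.image i)ᶜ,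
        g (insert z (univ.image i)) * (∑ w, deltaDet (Fin.cons z i : Fin (l + 1) → ι)
          (Fin.cons w j)) * (g (insert z' (univ.image i)) *
          ∑ w, deltaDet (Fin.cons z' i : Fin (l + 1) → ι) (Fin.cons w j)) =
        l ! * (g (insert z (univ.image i)) * upSum g (univ.image i) +
          l * (g (insert z (univ.image i)) * g (insert z (univ.image i)))) := by
      intro z hz
      rw [Finset.sum_comm]
      have h3 : ∀ z' ∈ (univ.image i)ᶜ, ∑ j,
        g (insert z (univ.image i)) * (∑ w, deltaDet (Fin.cons z i : Fin (l + 1) → ι)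
          (Fin.cons w j)) * (g (insert z' (univ.image i)) *
          ∑ w, deltaDet (Fin.cons z' i : Fin (l + 1) → ι) (Fin.cons w j)) =
        l ! * (g (insert z (univ.image i)) * g (insert z' (univ.image i))) +
          if z = z' then l ! * l * (g (insert z (univ.image i)) * g (insert z' (univ.image i)))
            else 0 := by
        intro z' hz'
        have := sum_face_mul_face hi (mem_compl.mp hz) (mem_compl.mp hz')
        calc _ = g (insert z (univ.image i)) * g (insert z' (univ.image i)) *
            ∑ j, (∑ w, deltaDet (Fin.cons z i : Fin (l + 1) → ι) (Fin.cons w j)) *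
              (∑ w, deltaDet (Fin.cons z' i : Fin (l + 1) → ι) (Fin.cons w j)) := by
              rw [Finset.mul_sum]
              exact Finset.sum_congr rfl fun j _ => by ring
          _ = _ := by
              rw [this]
              split_ifs <;> ring
      rw [Finset.sum_congr rfl h3, Finset.sum_add_distrib, Finset.sum_ite_eq, if_pos hz,
        ← Finset.mul_sum, ← Finset.mul_sum, upSum]
      ring
    rw [Finset.sum_congr rfl h2, ← Finset.mul_sum, Finset.sum_add_distrib, ← Finset.sum_mul,
      ← Finset.mul_sum]
    rfl
  · refine Finset.sum_eq_zero fun j _ => ?_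
    rw [faceTensor_apply, Finset.sum_eq_zero, zero_pow two_ne_zero]
    intro z _
    refine Finset.sum_eq_zero fun w _ => ?_
    rw [diagTensor_apply, deltaDet_eq_zero_of_not_injective, mul_zero]
    rw [Fin.cons_injective_iff]
    exact fun h => hi h.2

theorem sum_diagTensor_sq (g : Finset ι → ℝ) (i : Fin l → ι) :
    ∑ j, diagTensor l g i j ^ 2 = if Function.Injective i then
      l ! * g (univ.image i) ^ 2 else 0 := by
  have : ∑ j, diagTensor l g i j ^ 2 = g (univ.image i) ^ 2 * (l ! * deltaDet i i) := by
    rw [← sum_deltaDet_mul, Finset.mul_sum]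
    refine Finset.sum_congr rfl fun j _ => ?_
    rw [diagTensor_apply]
    ring
  rw [this]
  split_ifs with hi
  · rw [deltaDet_self hi]; ring
  · rw [deltaDet_eq_zero_of_not_injective hi]; ring

end DeltaDet

/-! ### The contraction form on diagonal tensors and on their faces -/

section DiagForm

variable {ι : Type*} [Fintype ι] [DecidableEq ι] {l : ℕ}

/-- The sum of `a(L) g(L) ^ 2` over the sets `L` of size `t`, where `a(L) = ∑ i ∈ L, a i`. -/
def levelSum (a : ι → ℝ) (t : ℕ) (g : Finset ι → ℝ) : ℝ :=
  ∑ L ∈ powersetCard t univ, (∑ x ∈ L, a x) * g L ^ 2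

theorem levelSum_zero (a : ι → ℝ) (g : Finset ι → ℝ) : levelSum a 0 g = 0 := by
  simp [levelSum]

theorem levelSum_congr (a : ι → ℝ) {t : ℕ} {g g' : Finset ι → ℝ}
    (h : ∀ L, L.card = t → g L = g' L) : levelSum a t g = levelSum a t g' :=
  Finset.sum_congr rfl fun L hL => by rw [h L (mem_powersetCard.mp hL).2]

theorem levelSum_const_mul (a : ι → ℝ) (t : ℕ) (c : ℝ) (g : Finset ι → ℝ) :
    levelSum a t (fun L => c * g L) = c ^ 2 * levelSum a t g := by
  rw [levelSum, levelSum, Finset.mul_sum]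
  exact Finset.sum_congr rfl fun L _ => by ring

theorem energy_diagTensor (a : ι → ℝ) (g : Finset ι → ℝ) :
    energy (diagonal a) (diagTensor (l + 1) g) (diagTensor (l + 1) g) =
      l ! * (l + 1)! * levelSum a (l + 1) g := by
  rw [energy_diagonal]
  simp only [← Finset.mul_sum, sum_diagTensor_sq, mul_ite, mul_zero]
  rw [← Finset.sum_filter, sum_injective_image_mul l a fun K => (l + 1)! * g K ^ 2, levelSum,
    mul_assoc, Finset.mul_sum _ _ ((l + 1)! : ℝ)]
  congr 1
  exact Finset.sum_congr rfl fun L _ => by ring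

/-- Summing over the enlarged set, each of its elements is left out of `a` exactly once, which
yields the factor `t`. -/
theorem sum_compl_insert_sq (a : ι → ℝ) (g : Finset ι → ℝ) (t : ℕ) :
    ∑ L ∈ powersetCard t univ, (∑ x ∈ L, a x) * ∑ z ∈ Lᶜ, g (insert z L) ^ 2 =
      t * levelSum a (t + 1) g := by
  rw [levelSum, Finset.mul_sum]
  have h1 : ∀ L ∈ powersetCard (t + 1) (univ : Finset ι),
      (t : ℝ) * ((∑ x ∈ L, a x) * g L ^ 2) = ∑ z ∈ L, (∑ x ∈ L.erase z, a x) * g L ^ 2 := by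
    intro L hL
    rw [← Finset.sum_mul]
    have : ∑ z ∈ L, ∑ x ∈ L.erase z, a x = ∑ z ∈ L, (∑ x ∈ L, a x - a z) :=
      Finset.sum_congr rfl fun z hz => by rw [← Finset.add_sum_erase L a hz]; ring
    rw [this, Finset.sum_sub_distrib, Finset.sum_const, (mem_powersetCard.mp hL).2, nsmul_eq_mul]
    push_cast
    ring
  rw [Finset.sum_congr rfl h1]
  simp only [Finset.mul_sum]
  rw [Finset.sum_sigma', Finset.sum_sigma']
  refine Finset.sum_bij' (fun c _ => ⟨insert c.2 c.1, c.2⟩) (fun c _ => ⟨c.1.erase c.2, c.2⟩)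
    ?_ ?_ ?_ ?_ ?_
  · rintro ⟨L, z⟩ h
    simp only [mem_sigma, mem_powersetCard, subset_univ, true_and, mem_compl] at h ⊢
    exact ⟨by rw [card_insert_of_notMem h.2, h.1], mem_insert_self _ _⟩
  · rintro ⟨L, z⟩ h
    simp only [mem_sigma, mem_powersetCard, subset_univ, true_and, mem_compl] at h ⊢
    exact ⟨by rw [card_erase_of_mem h.2, h.1]; rfl, notMem_erase _ _⟩
  · rintro ⟨L, z⟩ h
    simp only [mem_sigma, mem_powersetCard, subset_univ, true_and, mem_compl] at h
    simp only [erase_insert h.2]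
  · rintro ⟨L, z⟩ h
    simp only [mem_sigma, mem_powersetCard, subset_univ, true_and] at h
    simp only [insert_erase h.2]
  · rintro ⟨L, z⟩ h
    simp only [mem_sigma, mem_powersetCard, subset_univ, true_and, mem_compl] at h
    simp only [erase_insert h.2]

theorem energy_faceTensor (a : ι → ℝ) (g : Finset ι → ℝ) :
    energy (diagonal a) (faceTensor (l + 1) g) (faceTensor (l + 1) g) =
      l ! * (l + 1)! * (levelSum a (l + 1) (upSum g) + (l + 1) ^ 2 * levelSum a (l + 2) g) := by
  rw [energy_diagonal]
  simp only [← Finset.mul_sum, sum_faceTensor_sq, mul_ite, mul_zero]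
  rw [← Finset.sum_filter, sum_injective_image_mul l a fun K =>
    (l + 1)! * (upSum g K ^ 2 + ((l + 1 : ℕ) : ℝ) * ∑ z ∈ Kᶜ, g (insert z K) ^ 2)]
  have h := sum_compl_insert_sq a g (l + 1)
  have h2 : levelSum a (l + 1) (upSum g) + (l + 1) ^ 2 * levelSum a (l + 2) g =
      levelSum a (l + 1) (upSum g) + (l + 1) * (((l + 1 : ℕ) : ℝ) * levelSum a (l + 2) g) := by
    push_cast; ring
  rw [h2, ← h, levelSum, Finset.mul_sum _ _ ((l : ℝ) + 1), ← Finset.sum_add_distrib,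
    mul_assoc, Finset.mul_sum _ _ ((l + 1)! : ℝ)]
  congr 1
  refine Finset.sum_congr rfl fun L _ => ?_
  push_cast
  ring

theorem upSum_supSum (f : Finset ι → ℝ) (M r : ℕ) (L : Finset ι) (h : L.card + r + 1 = M) :
    upSum (fun L => r ! * supSum M f L) L = (r + 1)! * supSum M f L := by
  rw [upSum, ← Finset.mul_sum, sum_supSum_insert, show M - L.card = r + 1 by omega,
    Nat.factorial_succ]
  push_cast
  ring

/-- The part of `boolForm` coming from sets of size `t`. -/
def boolTerm (M : ℕ) (a : ι → ℝ) (f : Finset ι → ℝ) (t : ℕ) : ℝ :=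
  (((t - 1)! * (M - t)! : ℕ) : ℝ) * levelSum a t (supSum M f)

theorem boolTerm_zero (M : ℕ) (a : ι → ℝ) (f : Finset ι → ℝ) : boolTerm M a f 0 = 0 := by
  rw [boolTerm, levelSum_zero, mul_zero]

theorem boolForm_eq_sum (M : ℕ) (a : ι → ℝ) (f : Finset ι → ℝ) :
    boolForm M a f = ∑ t ∈ range (M + 1), boolTerm M a f t := by
  have h1 : boolForm M a f = ∑ L with L.card ∈ range (M + 1),
      (((L.card - 1)! * (M - L.card)! : ℕ) : ℝ) * (∑ i ∈ L, a i) * supSum M f L ^ 2 := by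
    rw [boolForm, Finset.sum_filter]
    refine Finset.sum_congr rfl fun L _ => ?_
    split_ifs with h
    · rfl
    · rw [supSum_of_card_lt _ (by simpa using h)]
      simp
  rw [h1, ← Finset.sum_fiberwise_of_maps_to (g := Finset.card) (t := range (M + 1))
    (fun L hL => (mem_filter.mp hL).2)]
  refine Finset.sum_congr rfl fun t ht => ?_
  rw [boolTerm, levelSum, Finset.mul_sum]
  refine Finset.sum_congr ?_ fun L hL => ?_
  · ext L
    simp only [mem_filter, mem_univ, true_and, mem_powersetCard, subset_univ]
    exact ⟨fun h => h.2, fun h => ⟨h ▸ ht, h⟩⟩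
  · rw [(mem_powersetCard.mp hL).2]
    ring

theorem contrForm_diagTensor_aux (a : ι → ℝ) (f : Finset ι → ℝ) (M : ℕ) : ∀ l r : ℕ, l + r = M →
    contrForm (diagonal a) l r (diagTensor l fun L => r ! * supSum M f L)
      (diagTensor l fun L => r ! * supSum M f L) = ∑ t ∈ range (l + 1), boolTerm M a f t := by
  intro l
  induction l with
  | zero => intro r _; simp [contrForm, boolTerm_zero]
  | succ l ih =>
    intro r hr
    rw [contrForm, contr_diagTensor, energy_diagTensor, levelSum_const_mul,
      diagTensor_congr (g' := fun L => (r + 1)! * supSum M f L)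
        (fun L hL => upSum_supSum f M r L (by omega)), ih (r + 1) (by omega),
      Finset.sum_range_succ _ (l + 1), add_comm]
    congr 1
    rw [boolTerm, show M - (l + 1) = r by omega, Nat.add_sub_cancel]
    have : ((l + 1)! : ℝ) ≠ 0 := by positivity
    have : (r ! : ℝ) ≠ 0 := by positivity
    push_cast
    field_simp

theorem contrForm_diagTensor (a : ι → ℝ) (f : Finset ι → ℝ) (M : ℕ) :
    contrForm (diagonal a) M 0 (diagTensor M f) (diagTensor M f) = boolForm M a f := by
  rw [boolForm_eq_sum, ← contrForm_diagTensor_aux a f M M 0 (add_zero M),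
    diagTensor_congr (g' := fun L => (0 ! : ℕ) * supSum M f L)]
  intro L hL
  rw [supSum_of_card_eq f hL]
  simp

/-- The level of size `t` enters twice: with `M - t` from the squares of `upSum` at order `t`, and
with `t - 1` from the sums of squares at order `t - 1`. Together they give the constant `M - 1`,
independent of `t`. -/
theorem contrForm_faceTensor_aux (a : ι → ℝ) (f : Finset ι → ℝ) (M : ℕ) : ∀ l r : ℕ,
    l + 1 + r = M →
    contrForm (diagonal a) l r (faceTensor l fun L => r ! * supSum M f L)
      (faceTensor l fun L => r ! * supSum M f L) =
      ∑ t ∈ range (l + 1), ((M : ℝ) - t) * boolTerm M a f t +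
        ∑ t ∈ range (l + 2), ((t : ℝ) - 1) * boolTerm M a f t := by
  intro l
  induction l with
  | zero => intro r _; simp [contrForm, Finset.sum_range_succ, boolTerm_zero]
  | succ l ih =>
    intro r hr
    rw [contrForm, contr_faceTensor, energy_faceTensor, levelSum_const_mul,
      levelSum_congr a (g' := fun L => (r + 1)! * supSum M f L)
        (fun L hL => upSum_supSum f M r L (by omega)), levelSum_const_mul,
      faceTensor_congr (g' := fun L => (r + 1)! * supSum M f L)
        (fun L hL => upSum_supSum f M r L (by omega)), ih (r + 1) (by omega),
      Finset.sum_range_succ (fun t : ℕ => ((M : ℝ) - t) * boolTerm M a f t) (l + 1),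
      Finset.sum_range_succ (fun t : ℕ => ((t : ℝ) - 1) * boolTerm M a f t) (l + 2)]
    generalize ∑ t ∈ range (l + 1), ((M : ℝ) - t) * boolTerm M a f t = s1
    generalize ∑ t ∈ range (l + 2), ((t : ℝ) - 1) * boolTerm M a f t = s2
    have e1 : boolTerm M a f (l + 1) = l ! * (r + 1)! * levelSum a (l + 1) (supSum M f) := by
      rw [boolTerm, show M - (l + 1) = r + 1 by omega, Nat.add_sub_cancel]
      push_cast
      ring
    have e2 : boolTerm M a f (l + 2) = (l + 1)! * r ! * levelSum a (l + 2) (supSum M f) := by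
      rw [boolTerm, show M - (l + 2) = r by omega, show l + 2 - 1 = l + 1 by omega]
      push_cast
      ring
    rw [e1, e2]
    have hM : (M : ℝ) = l + 2 + r := by
      rw [← hr]; push_cast; ring
    have : (l ! : ℝ) ≠ 0 := by positivity
    have : (r ! : ℝ) ≠ 0 := by positivity
    rw [hM]
    simp only [Nat.factorial_succ]
    push_cast
    field_simp
    ring

/-- The contraction form of a diagonal tensor of order `k + 1` is, up to the factor `k`, the
contraction form of its face tensor. -/
theorem contrForm_faceTensor (a : ι → ℝ) (f : Finset ι → ℝ) (k : ℕ) :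
    contrForm (diagonal a) k 0 (faceTensor k f) (faceTensor k f) = k * boolForm (k + 1) a f := by
  have h := contrForm_faceTensor_aux a f (k + 1) k 0 rfl
  rw [faceTensor_congr (g' := f)] at h
  · have h2 : ∑ t ∈ range (k + 1), (((k + 1 : ℕ) : ℝ) - t) * boolTerm (k + 1) a f t =
        ∑ t ∈ range (k + 2), (((k + 1 : ℕ) : ℝ) - t) * boolTerm (k + 1) a f t := by
      rw [Finset.sum_range_succ _ (k + 1)]
      simp
    rw [h, h2, ← Finset.sum_add_distrib, boolForm_eq_sum, Finset.mul_sum]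
    refine Finset.sum_congr rfl fun t _ => ?_
    push_cast
    ring
  · intro L hL
    rw [supSum_of_card_eq f hL]
    simp

end DiagForm

open Polynomial

/-! ### Positivity of the contraction form -/

/-- The `k`-th derivative of `p` has no positive zero. -/
def NoPosRoot (k : ℕ) (p : ℝ[X]) : Prop := ∀ s : ℝ, 0 < s → (derivative^[k] p).eval s ≠ 0

theorem Matrix.IsSymm.exists_diagonalization {n : ℕ} {T : Matrix (Fin n) (Fin n) ℝ}
    (hT : T.IsSymm) : ∃ (O : Matrix (Fin n) (Fin n) ℝ) (a : Fin n → ℝ),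
      Oᵀ * O = 1 ∧ T = Oᵀ * diagonal a * O := by
  have hT' : T.IsHermitian := isHermitian_iff_isSymm.mpr hT
  refine ⟨(hT'.eigenvectorUnitary : Matrix (Fin n) (Fin n) ℝ)ᵀ, hT'.eigenvalues, ?_, ?_⟩
  · have h := (Matrix.mem_unitaryGroup_iff (n := Fin n) (α := ℝ)).mp hT'.eigenvectorUnitary.2
    rw [transpose_transpose]
    rwa [star_eq_conjTranspose, conjTranspose_eq_transpose_of_trivial] at h
  · have h := hT'.spectral_theorem
    rw [Unitary.conjStarAlgAut_apply, star_eq_conjTranspose,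
      conjTranspose_eq_transpose_of_trivial] at h
    rw [transpose_transpose]
    exact h

theorem charpoly_neg_conj {n : ℕ} {O : Matrix (Fin n) (Fin n) ℝ} (hO : Oᵀ * O = 1)
    (a : Fin n → ℝ) : (-(Oᵀ * diagonal a * O)).charpoly = ∏ i, (X + C (a i)) := by
  have h1 : -(Oᵀ * diagonal a * O) = Oᵀ * (diagonal (-a) * O) := by
    rw [show diagonal (-a) = -diagonal a from (diagonal_neg a).symm,
      Matrix.neg_mul, Matrix.mul_neg, Matrix.mul_assoc]
  rw [h1, charpoly_mul_comm, Matrix.mul_assoc, mul_eq_one_comm.mp hO, Matrix.mul_one,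
    charpoly_diagonal]
  simp

theorem contrForm_nonneg_of_boolForm {n k : ℕ}
    (H : ∀ a : Fin n → ℝ, NoPosRoot k (∏ i, (X + C (a i))) → ∀ f, 0 ≤ boolForm (k + 1) a f)
    {T : Matrix (Fin n) (Fin n) ℝ} (hT : T.IsSymm) (hk : NoPosRoot k (-T).charpoly)
    {u : Matrix (Fin (k + 1) → Fin n) (Fin (k + 1) → Fin n) ℝ} (hu : IsAltSymm u) :
    0 ≤ contrForm T (k + 1) 0 u u := by
  obtain ⟨O, a, hO, rfl⟩ := hT.exists_diagonalization
  rw [charpoly_neg_conj hO] at hk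
  rw [← contrForm_push hO]
  exact contrForm_diagonal_nonneg (H a hk) (hu.push O)

/-- The diagonal matrix of `a`, compressed to the orthogonal complement of the all-ones vector. -/
theorem exists_compression (n : ℕ) : ∃ Q : Matrix (Fin (n + 1)) (Fin n) ℝ, Qᵀ * Q = 1 ∧
    (∀ i j, (Q * Qᵀ) i j = (if i = j then 1 else 0) - ((n + 1 : ℕ) : ℝ)⁻¹) ∧
    ∀ a : Fin (n + 1) → ℝ, derivative (∏ i, (X + C (a i))) =
      C ((n + 1 : ℕ) : ℝ) * (-(Qᵀ * diagonal a * Q)).charpoly := by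
  -- The normalized all-ones vector has all entries `c`; it becomes the first row of an orthogonal
  -- matrix `O`, and `Q` collects the remaining rows.
  set c : ℝ := (√((n + 1 : ℕ) : ℝ))⁻¹ with hc
  have hn : (0 : ℝ) < ((n + 1 : ℕ) : ℝ) := by positivity
  have hcc : c * c = ((n + 1 : ℕ) : ℝ)⁻¹ := by
    rw [hc, ← mul_inv, Real.mul_self_sqrt hn.le]
  obtain ⟨b, hb⟩ := Orthonormal.exists_orthonormalBasis_extension_of_card_eq (𝕜 := ℝ)
    (E := EuclideanSpace ℝ (Fin (n + 1))) (ι := Fin (n + 1)) (by simp)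
    (v := fun _ => WithLp.toLp 2 fun _ => c) (s := {0}) (by
      rw [orthonormal_iff_ite]
      rintro ⟨i, rfl⟩ ⟨j, rfl⟩
      simp only [Set.domRestrict_apply, PiLp.inner_apply, RCLike.inner_apply, conj_trivial, hcc]
      simp only [sum_const, card_univ, Fintype.card_fin, nsmul_eq_mul, if_true]
      exact mul_inv_cancel₀ hn.ne')
  set O : Matrix (Fin (n + 1)) (Fin (n + 1)) ℝ := of fun i j => b i j with hO
  have hO0 : ∀ j, O 0 j = c := fun j => by
    rw [hO, of_apply, hb 0 rfl]
  have hOO : O * Oᵀ = 1 := by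
    ext i j
    have := b.inner_eq_ite j i
    rw [PiLp.inner_apply] at this
    simp only [RCLike.inner_apply, conj_trivial] at this
    rw [mul_apply, one_apply]
    simp only [hO, of_apply, transpose_apply]
    rw [this]
    simp [eq_comm]
  have hOO' : Oᵀ * O = 1 := mul_eq_one_comm.mp hOO
  refine ⟨Oᵀ.submatrix id Fin.succ, ?_, ?_, ?_⟩
  · ext i j
    have := congrFun (congrFun hOO i.succ) j.succ
    rw [mul_apply] at this ⊢
    simpa [one_apply] using this
  · intro i j
    have := congrFun (congrFun hOO' i) j
    rw [mul_apply, Fin.sum_univ_succ, one_apply] at this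
    rw [mul_apply, ← this, ← hcc]
    simp [hO0]
  · intro a
    refine Polynomial.funext fun t => ?_
    rw [eval_mul, eval_C, eval_charpoly, derivative_prod_finset, eval_finsetSum]
    set D : Matrix (Fin (n + 1)) (Fin (n + 1)) ℝ := diagonal fun i => t + a i with hD
    have h1 : scalar (Fin n) t - -((Oᵀ.submatrix id Fin.succ)ᵀ * diagonal a *
        Oᵀ.submatrix id Fin.succ) = (O * D * Oᵀ).submatrix Fin.succ Fin.succ := by
      have : O * D * Oᵀ = scalar (Fin (n + 1)) t + O * diagonal a * Oᵀ := by
        have hD' : D = t • 1 + diagonal a := by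
          rw [hD, ← diagonal_one, ← diagonal_smul, diagonal_add]
          simp
        rw [hD', Matrix.mul_add, Matrix.add_mul, Matrix.mul_smul, Matrix.mul_one,
          Matrix.smul_mul, hOO]
        congr 1
        rw [scalar_apply, ← diagonal_one, ← diagonal_smul]
        congr 1
        ext i; simp
      rw [this]
      ext i j
      simp only [scalar_apply, sub_neg_eq_add, Matrix.add_apply, submatrix_apply, diagonal_apply,
        Fin.succ_inj]
      rfl
    -- The characteristic polynomial of the compression is a diagonal entry of the adjugate of `O *
    -- D * Oᵀ`, which equals `O * D.adjugate * Oᵀ`. As the first row of `O` is constant, this entry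
    -- is the mean of the products of the `t + a i` with one factor omitted.
    have h2 : ((O * D * Oᵀ).submatrix Fin.succ Fin.succ).det =
        (O * D * Oᵀ).adjugate 0 0 := by
      rw [adjugate_fin_succ_eq_det_submatrix]
      simp [Fin.succAbove_zero]
    have hdet : O.det * O.det = 1 := by
      have := congrArg det hOO
      rwa [det_mul, det_transpose, det_one] at this
    have hadj : O.adjugate = O.det • Oᵀ := by
      calc O.adjugate = O.adjugate * (O * Oᵀ) := by rw [hOO, Matrix.mul_one]
        _ = O.det • Oᵀ := by
          rw [← Matrix.mul_assoc, adjugate_mul, Matrix.smul_mul, Matrix.one_mul]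
    have hadj' : Oᵀ.adjugate = O.det • O := by
      rw [← adjugate_transpose, hadj, transpose_smul, transpose_transpose]
    have h3 : (O * D * Oᵀ).adjugate = O * D.adjugate * Oᵀ := by
      rw [adjugate_mul_distrib, adjugate_mul_distrib, hadj, hadj', Matrix.smul_mul,
        Matrix.mul_smul, Matrix.mul_smul, smul_smul, hdet, one_smul, Matrix.mul_assoc]
    rw [h1, h2, h3, hD, adjugate_diagonal, mul_apply]
    simp only [mul_diagonal, hO0, transpose_apply]
    rw [Finset.mul_sum]
    refine Finset.sum_congr rfl fun i _ => ?_
    rw [mul_right_comm c, hcc, ← mul_assoc, mul_inv_cancel₀ hn.ne', one_mul]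
    simp [eval_prod]

/-! ### Tensors supported on a hyperplane -/

section Killed

variable {ι κ : Type*} [Fintype ι] [DecidableEq ι] {l : ℕ}

/-- The matrix `π` differs from the identity by a multiple of the all-ones matrix, which annihilates
`f` in every slot. -/
theorem sum_tensorPow_mul_eq {π : Matrix ι ι ℝ} {c : ℝ}
    (hπ : ∀ i j, π i j = (if i = j then 1 else 0) - c) : ∀ (l : ℕ) (f : (Fin l → ι) → ℝ),
    (∀ q i, ∑ y, f (Function.update i q y) = 0) → ∀ i, ∑ x, tensorPow l π i x * f x = f i := by
  intro l
  induction l with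
  | zero =>
    intro f _ i
    rw [Fintype.sum_unique, Subsingleton.elim i default]
    simp [tensorPow]
  | succ l ih =>
    intro f hf i
    obtain ⟨z, i, rfl⟩ : ∃ z i', i = Fin.cons z i' := ⟨i 0, Fin.tail i, (Fin.cons_self_tail i).symm⟩
    rw [sum_fin_cons]
    have h1 : ∀ x0, ∑ x : Fin l → ι, tensorPow (l + 1) π (Fin.cons z i) (Fin.cons x0 x) *
        f (Fin.cons x0 x) = π z x0 * f (Fin.cons x0 i) := by
      intro x0
      rw [← ih (fun x => f (Fin.cons x0 x)) (fun q x => ?_) i, Finset.mul_sum]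
      · refine Finset.sum_congr rfl fun x _ => ?_
        rw [tensorPow_cons, mul_assoc]
      · rw [← hf q.succ (Fin.cons x0 x)]
        simp only [Fin.cons_update]
    have h2 := hf 0 (Fin.cons z i)
    simp only [Fin.update_cons_zero] at h2
    simp only [h1, hπ, sub_mul, Finset.sum_sub_distrib, ← Finset.mul_sum, h2]
    simp

theorem IsAltSymm.push_push_transpose [Fintype κ] [DecidableEq κ]
    {u : Matrix (Fin (l + 1) → ι) (Fin (l + 1) → ι) ℝ} (hu : IsAltSymm u)
    (h0 : ∀ i j, ∑ y, u (Fin.cons y i) j = 0) {Q : Matrix ι κ ℝ} {c : ℝ}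
    (hQ : ∀ i j, (Q * Qᵀ) i j = (if i = j then 1 else 0) - c) :
    _root_.push Q (_root_.push Qᵀ u) = u := by
  -- Vanishing in the first slot carries over to slot `q` by the alternating property.
  have hkill : ∀ q i j, ∑ y, u (Function.update i q y) j = 0 := by
    intro q i j
    have h : ∀ y, Function.update i q y =
        (Fin.cons y (Fin.tail (i ∘ Equiv.swap 0 q)) : Fin (l + 1) → ι) ∘ Equiv.swap 0 q := by
      intro y
      ext p
      rw [Function.comp]
      by_cases hp : p = q
      · subst hp
        rw [Equiv.swap_apply_right]
        simp
      · rw [Function.update_of_ne hp]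
        have hp0 : Equiv.swap 0 q p ≠ 0 := by
          rw [Ne, Equiv.swap_apply_eq_iff, Equiv.swap_apply_left]
          exact hp
        obtain ⟨p', hp'⟩ := Fin.exists_succ_eq.mpr hp0
        rw [← hp', Fin.cons_succ, Fin.tail, hp', Function.comp, Equiv.swap_apply_self]
    simp only [h, hu.perm, ← Finset.mul_sum, h0, mul_zero]
  have hmul : tensorPow (l + 1) (Q * Qᵀ) * u = u := by
    ext i j
    rw [mul_apply]
    exact sum_tensorPow_mul_eq hQ _ (fun x => u x j) (fun q x => hkill q x j) i
  have hsymm : uᵀ = u := by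
    ext i j
    exact hu.symm j i
  have hpow : tensorPow (l + 1) Q * (tensorPow (l + 1) Qᵀ : Matrix _ _ ℝ) =
      tensorPow (l + 1) (Q * Qᵀ) := piTensor_mul _ _
  have hpow' : ((tensorPow (l + 1) Qᵀ)ᵀ : Matrix _ _ ℝ) * (tensorPow (l + 1) Q)ᵀ =
      (tensorPow (l + 1) (Q * Qᵀ))ᵀ := by
    rw [← transpose_mul, hpow]
  rw [_root_.push, _root_.push]
  calc _ = (tensorPow (l + 1) Q * (tensorPow (l + 1) Qᵀ : Matrix _ _ ℝ)) * u *
        (((tensorPow (l + 1) Qᵀ)ᵀ : Matrix _ _ ℝ) * (tensorPow (l + 1) Q)ᵀ) := by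
        simp only [Matrix.mul_assoc]
    _ = u := by
        rw [hpow, hpow', hmul]
        calc _ = (tensorPow (l + 1) (Q * Qᵀ) * uᵀ)ᵀ := by rw [transpose_mul, transpose_transpose]
          _ = u := by rw [hsymm, hmul, hsymm]

end Killed

/-- For `k = 0` all `a i` are nonnegative, and so is every summand. In the inductive step the face
tensor of `f` is recovered from its push to the hyperplane, so its form for `diagonal a` equals that
of the pushed tensor for the compression, whose characteristic polynomial carries the derivative. -/
theorem boolForm_nonneg (k : ℕ) : ∀ (n : ℕ) (a : Fin n → ℝ),
    NoPosRoot k (∏ i, (X + C (a i))) → ∀ f, 0 ≤ boolForm (k + 1) a f := by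
  induction k with
  | zero =>
    intro n a ha f
    have hpos : ∀ i, 0 ≤ a i := by
      intro i
      by_contra h
      refine ha (-a i) (by linarith) ?_
      rw [Function.iterate_zero, id, eval_prod]
      exact Finset.prod_eq_zero (mem_univ i) (by simp)
    exact Finset.sum_nonneg fun L _ => mul_nonneg (mul_nonneg (by positivity)
      (Finset.sum_nonneg fun i _ => hpos i)) (sq_nonneg _)
  | succ k ih =>
    intro n a ha f
    rcases n with _ | n
    · exact Finset.sum_nonneg fun L _ => by
        rw [L.eq_empty_of_isEmpty]
        simp
    obtain ⟨Q, hQ1, hQ2, hQ3⟩ := exists_compression n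
    have hT : (Qᵀ * diagonal a * Q).IsSymm := by
      rw [Matrix.IsSymm, transpose_mul, transpose_mul, transpose_transpose, diagonal_transpose,
        Matrix.mul_assoc]
    have hk : NoPosRoot k (-(Qᵀ * diagonal a * Q)).charpoly := by
      intro s hs h
      refine ha s hs ?_
      rw [Function.iterate_succ_apply, hQ3, iterate_derivative_C_mul, eval_mul, h, mul_zero]
    have hF := faceTensor_isAltSymm (l := k + 1) f
    have h := contrForm_nonneg_of_boolForm (ih n) hT hk (hF.push Qᵀ)
    rw [← contrForm_push hQ1, hF.push_push_transpose (sum_faceTensor_cons f) hQ2,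
      contrForm_faceTensor] at h
    exact nonneg_of_mul_nonneg_right h (by positivity)

theorem contrForm_nonneg {n k : ℕ} {T : Matrix (Fin n) (Fin n) ℝ} (hT : T.IsSymm)
    (hk : NoPosRoot k (-T).charpoly)
    {u : Matrix (Fin (k + 1) → Fin n) (Fin (k + 1) → Fin n) ℝ} (hu : IsAltSymm u) :
    0 ≤ contrForm T (k + 1) 0 u u :=
  contrForm_nonneg_of_boolForm (boolForm_nonneg k n) hT hk hu

/-! ### Test vectors -/

section TestVector

variable {ι : Type*} [Fintype ι] [DecidableEq ι]

/-- Induction on `A`: the summands of `J` and `insert x J` for `N + 1` add up to `N + 2` times the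
summand of `J` for `N`. -/
theorem sum_powerset_factorial (A : Finset ι) : ∀ N : ℕ, A.card ≤ N →
    (∑ J ∈ A.powerset, J.card ! * (N - J.card)!) * (N + 1 - A.card) = (N + 1)! := by
  induction A using Finset.induction_on with
  | empty =>
    intro N _
    simp [Nat.factorial_succ, mul_comm]
  | insert x A hx ih =>
    intro N hN
    rw [card_insert_of_notMem hx] at hN ⊢
    obtain ⟨N, rfl⟩ : ∃ N', N = N' + 1 := ⟨N - 1, by omega⟩
    have h := ih N (by omega)
    rw [sum_powerset_insert hx, ← Finset.sum_add_distrib]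
    have h2 : ∀ J ∈ A.powerset, J.card ! * (N + 1 - J.card)! +
        (insert x J).card ! * (N + 1 - (insert x J).card)! =
        (N + 2) * (J.card ! * (N - J.card)!) := by
      intro J hJ
      have hJA := mem_powerset.mp hJ
      have hc := card_le_card hJA
      rw [card_insert_of_notMem fun h => hx (hJA h)]
      obtain ⟨d, hd⟩ : ∃ d, N = J.card + d := ⟨N - J.card, by omega⟩
      rw [hd, show J.card + d + 1 - J.card = d + 1 by omega,
        show J.card + d + 1 - (J.card + 1) = d by omega, Nat.add_sub_cancel_left,
        Nat.factorial_succ, Nat.factorial_succ]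
      ring
    rw [Finset.sum_congr rfl h2, ← Finset.mul_sum, mul_assoc,
      show N + 1 + 1 - (A.card + 1) = N + 1 - A.card by omega, h, ← Nat.factorial_succ]

theorem sum_factorial_of_mem {I : Finset ι} {i : ι} (hi : i ∈ I) {k : ℕ} (hk : I.card ≤ k + 1) :
    (∑ L ∈ I.powerset with i ∈ L, (L.card - 1)! * (k + 1 - L.card)!) * (k + 2 - I.card) =
      (k + 1)! := by
  have h := sum_powerset_factorial (I.erase i) k (by rw [card_erase_of_mem hi]; omega)
  have hI : 0 < I.card := card_pos.mpr ⟨i, hi⟩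
  rw [card_erase_of_mem hi, show k + 1 - (I.card - 1) = k + 2 - I.card by omega] at h
  rw [← h]
  congr 1
  refine Finset.sum_bij' (fun L _ => L.erase i) (fun J _ => insert i J) ?_ ?_ ?_ ?_ ?_
  · intro L hL
    rw [mem_filter, mem_powerset] at hL
    exact mem_powerset.mpr (erase_subset_erase _ hL.1)
  · intro J hJ
    rw [mem_powerset] at hJ
    rw [mem_filter, mem_powerset]
    exact ⟨insert_subset hi (hJ.trans (erase_subset _ _)), mem_insert_self _ _⟩
  · intro L hL
    exact insert_erase (mem_filter.mp hL).2
  · intro J hJ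
    exact erase_insert fun h => notMem_erase i I (mem_powerset.mp hJ h)
  · intro L hL
    have hiL := (mem_filter.mp hL).2
    have hL0 : 0 < L.card := card_pos.mpr ⟨i, hiL⟩
    rw [card_erase_of_mem hiL, show k + 1 - L.card = k - (L.card - 1) by omega]

/-- The product of the `a i` over the complement of a set. -/
def coProd (a : ι → ℝ) (S : Finset ι) : ℝ := ∏ i ∈ Sᶜ, a i

/-- The sum of the products of the `a i` over the complements of the sets of size `j`. -/
def coEsymm (a : ι → ℝ) (j : ℕ) : ℝ := ∑ R ∈ powersetCard j univ, coProd a R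

/-- Up to a constant, the partial derivative of `boolForm` at `coProd a` in the coordinate `S`. It
does not depend on `S`, which makes the value of the form a product. -/
theorem sum_powerset_coProd (a : ι → ℝ) {k : ℕ} {S : Finset ι} (hS : S.card = k + 1) :
    ∑ L ∈ S.powerset, (((L.card - 1)! * (k + 1 - L.card)! : ℕ) : ℝ) * (∑ i ∈ L, a i) *
      supSum (k + 1) (coProd a) L = (k + 1)! * coEsymm a k := by
  have h1 : ∀ L ∈ S.powerset, (((L.card - 1)! * (k + 1 - L.card)! : ℕ) : ℝ) * (∑ i ∈ L, a i) *
      supSum (k + 1) (coProd a) L = ∑ T ∈ powersetCard (k + 1) univ, ∑ i ∈ S ∩ T,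
        if i ∈ L ∧ L ⊆ S ∩ T then
          a i * coProd a T * (((L.card - 1)! * (k + 1 - L.card)! : ℕ) : ℝ) else 0 := by
    intro L hL
    rw [mem_powerset] at hL
    have h : supSum (k + 1) (coProd a) L =
        ∑ T ∈ powersetCard (k + 1) univ, if L ⊆ T then coProd a T else 0 := by
      rw [supSum, ← Finset.sum_filter]
      refine Finset.sum_congr ?_ fun _ _ => rfl
      ext T
      simp [and_comm]
    rw [h, Finset.mul_sum]
    refine Finset.sum_congr rfl fun T _ => ?_
    by_cases hLT : L ⊆ T
    · have hLI : L ⊆ S ∩ T := subset_inter hL hLT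
      simp only [hLT, hLI, and_true, if_true]
      rw [← Finset.sum_filter, Finset.filter_mem_eq_inter, inter_eq_right.mpr hLI, Finset.mul_sum,
        Finset.sum_mul]
      exact Finset.sum_congr rfl fun i _ => by ring
    · rw [if_neg hLT, mul_zero]
      symm
      refine Finset.sum_eq_zero fun i _ => if_neg fun h' => hLT ?_
      exact h'.2.trans inter_subset_right
  rw [Finset.sum_congr rfl h1, Finset.sum_comm]
  have h2 : ∀ T ∈ powersetCard (k + 1) (univ : Finset ι), ∑ L ∈ S.powerset, ∑ i ∈ S ∩ T,
      (if i ∈ L ∧ L ⊆ S ∩ T then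
          a i * coProd a T * (((L.card - 1)! * (k + 1 - L.card)! : ℕ) : ℝ) else 0) =
      ∑ i ∈ S ∩ T, a i * coProd a T * ((k + 1)! / ((k + 2 - (S ∩ T).card : ℕ) : ℝ)) := by
    intro T hT
    rw [Finset.sum_comm]
    refine Finset.sum_congr rfl fun i hi => ?_
    have hc : (S ∩ T).card ≤ k + 1 := hS ▸ card_le_card inter_subset_left
    have h := sum_factorial_of_mem hi hc
    have hne : ((k + 2 - (S ∩ T).card : ℕ) : ℝ) ≠ 0 := by
      rw [Nat.cast_ne_zero]; omega
    rw [← h, Nat.cast_mul, mul_div_cancel_right₀ _ hne, Nat.cast_sum, Finset.mul_sum,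
      Finset.sum_filter, ← Finset.sum_subset (powerset_mono.mpr (inter_subset_left (s₂ := T)))]
    · refine Finset.sum_congr rfl fun L hL => ?_
      simp [mem_powerset.mp hL]
    · intro L _ hL
      rw [mem_powerset] at hL
      exact if_neg fun h' => hL h'.2
  rw [Finset.sum_congr rfl h2, coEsymm, Finset.mul_sum]
  -- Each `R` is spread evenly over the elements `i` of `S \ R`. With `T = insert i R` one has `a i
  -- * coProd a T = coProd a R`, and `S \ R` has `k + 2 - (S ∩ T).card` elements, the denominator in
  -- `h2`.
  have h3 : ∀ R ∈ powersetCard k (univ : Finset ι), ((k + 1)! : ℝ) * coProd a R =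
      ∑ i ∈ S \ R, coProd a R * ((k + 1)! / ((S \ R).card : ℝ)) := by
    intro R hR
    have hR := (mem_powersetCard.mp hR).2
    have : 0 < (S \ R).card := by
      have := le_card_sdiff R S
      omega
    have : ((S \ R).card : ℝ) ≠ 0 := by positivity
    rw [Finset.sum_const, nsmul_eq_mul]
    field_simp
  rw [Finset.sum_congr rfl h3, Finset.sum_sigma', Finset.sum_sigma']
  refine Finset.sum_bij' (fun c _ => ⟨c.1.erase c.2, c.2⟩) (fun c _ => ⟨insert c.2 c.1, c.2⟩)
    ?_ ?_ ?_ ?_ ?_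
  · rintro ⟨T, i⟩ h
    simp only [mem_sigma, mem_powersetCard, subset_univ, true_and, mem_inter] at h
    simp only [mem_sigma, mem_powersetCard, subset_univ, true_and, mem_sdiff]
    exact ⟨by rw [card_erase_of_mem h.2.2, h.1]; rfl, h.2.1, notMem_erase _ _⟩
  · rintro ⟨R, i⟩ h
    simp only [mem_sigma, mem_powersetCard, subset_univ, true_and, mem_sdiff] at h
    simp only [mem_sigma, mem_powersetCard, subset_univ, true_and, mem_inter]
    exact ⟨by rw [card_insert_of_notMem h.2.2, h.1], h.2.1, mem_insert_self _ _⟩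
  · rintro ⟨T, i⟩ h
    simp only [mem_sigma, mem_inter] at h
    simp only [insert_erase h.2.2]
  · rintro ⟨R, i⟩ h
    simp only [mem_sigma, mem_sdiff] at h
    simp only [erase_insert h.2.2]
  · rintro ⟨T, i⟩ h
    simp only [mem_sigma, mem_powersetCard, subset_univ, true_and, mem_inter] at h
    obtain ⟨hT, hiS, hiT⟩ := h
    have e1 : coProd a (T.erase i) = a i * coProd a T := by
      rw [coProd, coProd, compl_erase, Finset.prod_insert (by simpa using hiT)]
    have e2 : (S \ T.erase i).card = k + 2 - (S ∩ T).card := by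
      have h4 : S \ T.erase i = insert i (S \ T) := by
        ext x
        simp only [mem_sdiff, mem_erase, mem_insert]
        by_cases hx : x = i
        · subst hx; simp [hiS]
        · simp [hx]
      have := card_sdiff_add_card_inter S T
      rw [h4, card_insert_of_notMem (by simp [hiT])]
      omega
    simp only [e1, e2]

theorem boolForm_coProd (a : ι → ℝ) (k : ℕ) :
    boolForm (k + 1) a (coProd a) = (k + 1)! * coEsymm a k * coEsymm a (k + 1) := by
  have h1 : boolForm (k + 1) a (coProd a) = ∑ S ∈ powersetCard (k + 1) univ, coProd a S *
      ∑ L ∈ S.powerset, (((L.card - 1)! * (k + 1 - L.card)! : ℕ) : ℝ) * (∑ i ∈ L, a i) *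
      supSum (k + 1) (coProd a) L := by
    rw [Finset.sum_congr rfl fun S _ => Finset.mul_sum _ _ _, Finset.sum_comm' (t' := univ)
      (s' := fun L => ({S | L ⊆ S ∧ S.card = k + 1} : Finset (Finset ι)))
      (by intro S L; simp [and_comm])]
    refine Finset.sum_congr rfl fun L _ => ?_
    rw [pow_two, ← mul_assoc]
    nth_rewrite 2 [supSum]
    rw [Finset.mul_sum]
    exact Finset.sum_congr rfl fun S _ => by ring
  rw [h1, coEsymm.eq_1 a (k + 1), Finset.mul_sum]
  refine Finset.sum_congr rfl fun S hS => ?_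
  rw [sum_powerset_coProd a (mem_powersetCard.mp hS).2]
  ring

theorem eval_iterate_derivative_prod (a : ι → ℝ) (j : ℕ) (s : ℝ) :
    (derivative^[j] (∏ i, (X + C (a i)))).eval s = j ! * coEsymm (fun i => a i + s) j := by
  have h1 : taylor s (∏ i, (X + C (a i))) = ∏ i, (X + C (a i + s)) := by
    rw [taylor_apply, Polynomial.prod_comp]
    refine Finset.prod_congr rfl fun i _ => ?_
    simp only [add_comp, X_comp, C_comp, C_add]
    ring
  rw [← factorial_smul_hasseDeriv, LinearMap.smul_apply, eval_smul, ← taylor_coeff, h1,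
    nsmul_eq_mul, Finset.prod_add, finsetSum_coeff, coEsymm, powerset_univ,
    ← Finset.univ_filter_card_eq]
  congr 1
  rw [Finset.sum_filter]
  refine Finset.sum_congr rfl fun R _ => ?_
  rw [Finset.prod_const, ← map_prod C, mul_comm, coeff_C_mul, coeff_X_pow, coProd,
    compl_eq_univ_sdiff]
  by_cases h : R.card = j
  · simp [h]
  · simp [h, Ne.symm h]

end TestVector

theorem iterate_derivative_ne_zero {p : ℝ[X]} (hp : p ≠ 0) {k : ℕ} (hk : k ≤ p.natDegree) :
    derivative^[k] p ≠ 0 := by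
  intro h
  have := congrArg (fun q => coeff q (p.natDegree - k)) h
  simp only [coeff_iterate_derivative, coeff_zero, Nat.sub_add_cancel hk, coeff_natDegree,
    smul_eq_zero, leadingCoeff_eq_zero, hp, or_false, Nat.descFactorial_eq_zero_iff_lt] at this
  omega

/-- The square of `g` is monotone on `[0, ∞)`, so a zero at `s > 0` makes `g` vanish on all of `[0,
s]`. -/
theorem eval_ne_zero_of_mul_derivative_nonneg {g : ℝ[X]} (hg : g ≠ 0)
    (h : ∀ s : ℝ, 0 ≤ s → 0 ≤ g.eval s * g.derivative.eval s) {s : ℝ} (hs : 0 < s) :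
    g.eval s ≠ 0 := by
  intro h0
  have hmono : MonotoneOn (fun t => (g ^ 2).eval t) (Set.Ici 0) := by
    refine monotoneOn_of_deriv_nonneg (convex_Ici 0) (g ^ 2).continuous.continuousOn
      (g ^ 2).differentiable.differentiableOn fun t ht => ?_
    rw [interior_Ici] at ht
    rw [Polynomial.deriv, derivative_pow]
    have := h t (le_of_lt ht)
    simp only [eval_mul, map_natCast, eval_natCast, Nat.add_one_sub_one, pow_one]
    push_cast
    linarith
  refine hg (eq_zero_of_infinite_isRoot g ((Set.Icc_infinite hs).mono fun t ht => ?_))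
  have h1 := hmono (Set.mem_Ici.mpr ht.1) (Set.mem_Ici.mpr hs.le) ht.2
  simp only [eval_pow, h0] at h1
  have h2 : g.eval t ^ 2 = 0 := le_antisymm (by simpa using h1) (sq_nonneg _)
  exact pow_eq_zero_iff two_ne_zero |>.mp h2

theorem noPosRoot_of_boolForm_nonneg {n k : ℕ} (hk : k ≤ n) (a : Fin n → ℝ)
    (h : ∀ s : ℝ, 0 ≤ s → ∀ f, 0 ≤ boolForm (k + 1) (fun i => a i + s) f) :
    NoPosRoot k (∏ i, (X + C (a i))) := by
  have hmonic : (∏ i, (X + C (a i))).Monic := monic_prod_of_monic _ _ fun i _ => monic_X_add_C _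
  have hdeg : (∏ i, (X + C (a i))).natDegree = n := by
    rw [natDegree_prod_of_monic _ _ fun i _ => monic_X_add_C _]
    simp
  intro s hs
  refine eval_ne_zero_of_mul_derivative_nonneg
    (iterate_derivative_ne_zero hmonic.ne_zero (hdeg.symm ▸ hk)) (fun t ht => ?_) hs
  rw [← Function.iterate_succ_apply' (f := derivative), eval_iterate_derivative_prod,
    eval_iterate_derivative_prod]
  have h2 := h t ht (coProd fun i => a i + t)
  rw [boolForm_coProd] at h2
  have h3 : (0 : ℝ) < (k + 1)! := by positivity
  have h4 : 0 ≤ coEsymm (fun i => a i + t) k * coEsymm (fun i => a i + t) (k + 1) := by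
    rw [mul_assoc] at h2
    exact nonneg_of_mul_nonneg_right h2 h3
  have h5 : (0 : ℝ) ≤ k ! * (k + 1)! := by positivity
  calc 0 ≤ (k ! * (k + 1)! : ℝ) *
      (coEsymm (fun i => a i + t) k * coEsymm (fun i => a i + t) (k + 1)) := mul_nonneg h5 h4
    _ = _ := by ring

/-- Positivity at `T` passes to `T + s` for every `s ≥ 0`; restricting to diagonal tensors in an
eigenbasis gives the forms `boolForm` at the shifted eigenvalues. -/
theorem noPosRoot_of_contrForm_nonneg {n k : ℕ} (hk : k ≤ n) {T : Matrix (Fin n) (Fin n) ℝ}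
    (hT : T.IsSymm) (h : ∀ u : Matrix (Fin (k + 1) → Fin n) (Fin (k + 1) → Fin n) ℝ,
      IsAltSymm u → 0 ≤ contrForm T (k + 1) 0 u u) : NoPosRoot k (-T).charpoly := by
  obtain ⟨O, a, hO, rfl⟩ := hT.exists_diagonalization
  rw [charpoly_neg_conj hO]
  have hO' : O * Oᵀ = 1 := mul_eq_one_comm.mp hO
  refine noPosRoot_of_boolForm_nonneg hk a fun s hs f => ?_
  have h1 : diagonal (fun i => a i + s) = diagonal a + s • 1 := by
    rw [← diagonal_one, ← diagonal_smul, diagonal_add]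
    simp
  have h2 : diagonal a = (Oᵀ)ᵀ * (Oᵀ * diagonal a * O) * Oᵀ := by
    rw [transpose_transpose, Matrix.mul_assoc, Matrix.mul_assoc, Matrix.mul_assoc, hO',
      Matrix.mul_one, ← Matrix.mul_assoc, hO', Matrix.one_mul]
  rw [← contrForm_diagTensor, h1, contrForm_add_matrix, contrForm_smul_matrix, h2,
    ← contrForm_push (by rwa [transpose_transpose])]
  exact add_nonneg (h _ ((diagTensor_isAltSymm f).push _))
    (mul_nonneg hs (contrForm_one_nonneg _ _ _))

/-! ### The linear matrix inequality -/

section Gram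

variable {ι : Type*} [Fintype ι] [DecidableEq ι] {m : ℕ}

/-- Antisymmetrization in the rows and in the columns, followed by symmetrization. -/
def altProj (u : Matrix (Fin m → ι) (Fin m → ι) ℝ) : Matrix (Fin m → ι) (Fin m → ι) ℝ :=
  of fun i j => ∑ σ : Equiv.Perm (Fin m), ∑ τ : Equiv.Perm (Fin m),
    ((Equiv.Perm.sign σ : ℤ) : ℝ) * ((Equiv.Perm.sign τ : ℤ) : ℝ) *
      (u (i ∘ σ) (j ∘ τ) + u (j ∘ τ) (i ∘ σ))

theorem altProj_apply (u : Matrix (Fin m → ι) (Fin m → ι) ℝ) (i j) :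
    altProj u i j = ∑ σ : Equiv.Perm (Fin m), ∑ τ : Equiv.Perm (Fin m),
    ((Equiv.Perm.sign σ : ℤ) : ℝ) * ((Equiv.Perm.sign τ : ℤ) : ℝ) *
      (u (i ∘ σ) (j ∘ τ) + u (j ∘ τ) (i ∘ σ)) := rfl

theorem altProj_isAltSymm (u : Matrix (Fin m → ι) (Fin m → ι) ℝ) : IsAltSymm (altProj u) where
  perm ρ i j := by
    rw [altProj_apply, altProj_apply, ← Equiv.sum_comp (Equiv.mulLeft ρ⁻¹), Finset.mul_sum]
    refine Finset.sum_congr rfl fun σ _ => ?_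
    rw [Finset.mul_sum]
    refine Finset.sum_congr rfl fun τ _ => ?_
    have : (i ∘ ρ) ∘ (Equiv.mulLeft ρ⁻¹ σ : Equiv.Perm (Fin m)) = i ∘ σ := by
      ext q; simp
    rw [this]
    simp only [Equiv.coe_mulLeft, Equiv.Perm.sign_mul, Equiv.Perm.sign_inv, Units.val_mul,
      Int.cast_mul]
    ring
  symm i j := by
    rw [altProj_apply, altProj_apply, Finset.sum_comm]
    refine Finset.sum_congr rfl fun σ _ => Finset.sum_congr rfl fun τ _ => ?_
    ring

theorem altProj_add (u v : Matrix (Fin m → ι) (Fin m → ι) ℝ) :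
    altProj (u + v) = altProj u + altProj v := by
  ext i j
  rw [Matrix.add_apply, altProj_apply, altProj_apply, altProj_apply, ← Finset.sum_add_distrib]
  refine Finset.sum_congr rfl fun σ _ => ?_
  rw [← Finset.sum_add_distrib]
  refine Finset.sum_congr rfl fun τ _ => ?_
  simp only [Matrix.add_apply]
  ring

theorem altProj_smul (c : ℝ) (u : Matrix (Fin m → ι) (Fin m → ι) ℝ) :
    altProj (c • u) = c • altProj u := by
  ext i j
  rw [Matrix.smul_apply, altProj_apply, altProj_apply, smul_eq_mul, Finset.mul_sum]
  refine Finset.sum_congr rfl fun σ _ => ?_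
  rw [Finset.mul_sum]
  refine Finset.sum_congr rfl fun τ _ => ?_
  simp only [Matrix.smul_apply, smul_eq_mul]
  ring

theorem IsAltSymm.altProj_eq {u : Matrix (Fin m → ι) (Fin m → ι) ℝ} (hu : IsAltSymm u) :
    altProj u = (2 * (m ! : ℝ) ^ 2) • u := by
  ext i j
  have h : ∀ σ τ : Equiv.Perm (Fin m),
      ((Equiv.Perm.sign σ : ℤ) : ℝ) * ((Equiv.Perm.sign τ : ℤ) : ℝ) *
      (u (i ∘ σ) (j ∘ τ) + u (j ∘ τ) (i ∘ σ)) = 2 * u i j := by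
    intro σ τ
    rw [hu.symm (j ∘ τ), hu.perm, hu.perm_right]
    rcases Int.units_eq_one_or (Equiv.Perm.sign σ) with h | h <;>
    rcases Int.units_eq_one_or (Equiv.Perm.sign τ) with h' | h' <;>
    · simp only [h, h', Units.val_one, Units.val_neg, Int.cast_one, Int.cast_neg]
      ring
  rw [altProj_apply, Matrix.smul_apply, smul_eq_mul]
  simp only [h, Finset.sum_const, card_univ, Fintype.card_perm, Fintype.card_fin, nsmul_eq_mul]
  ring

/-- A vector indexed by pairs of tuples, as a square tensor. -/
def toTensor (x : (Fin m → ι) × (Fin m → ι) → ℝ) : Matrix (Fin m → ι) (Fin m → ι) ℝ :=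
  of fun i j => x (i, j)

/-- The bilinear form underlying the linear matrix inequality. -/
noncomputable def gramBilin (m : ℕ) {T : Matrix ι ι ℝ} (hT : T.IsSymm) :
    ((Fin m → ι) × (Fin m → ι) → ℝ) →ₗ[ℝ] ((Fin m → ι) × (Fin m → ι) → ℝ) →ₗ[ℝ] ℝ :=
  have add (x y z : (Fin m → ι) × (Fin m → ι) → ℝ) :
      contrForm T m 0 (altProj (toTensor (x + y))) (altProj (toTensor z)) =
      contrForm T m 0 (altProj (toTensor x)) (altProj (toTensor z)) +
      contrForm T m 0 (altProj (toTensor y)) (altProj (toTensor z)) := by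
    rw [← contrForm_add_left, ← altProj_add]; rfl
  have smul (c : ℝ) (x y : (Fin m → ι) × (Fin m → ι) → ℝ) :
      contrForm T m 0 (altProj (toTensor (c • x))) (altProj (toTensor y)) =
      c * contrForm T m 0 (altProj (toTensor x)) (altProj (toTensor y)) := by
    rw [← contrForm_smul_left, ← altProj_smul]; rfl
  LinearMap.mk₂ ℝ
    (fun x y => contrForm T m 0 (altProj (toTensor x)) (altProj (toTensor y)))
    (fun x y z => add x y z) (fun c x y => smul c x y)
    (fun x y z => by
      rw [contrForm_comm hT, add y z x, contrForm_comm hT m 0 (altProj (toTensor x)),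
        contrForm_comm hT m 0 (altProj (toTensor x))])
    (fun c x y => by
      rw [contrForm_comm hT, smul c y x, contrForm_comm hT m 0 (altProj (toTensor x))]; rfl)

/-- The Gram matrix of the contraction form on alternating tensors, linear in `T`. -/
noncomputable def altGram (m : ℕ) : Matrix ι ι ℝ →ₗ[ℝ]
    Matrix ((Fin m → ι) × (Fin m → ι)) ((Fin m → ι) × (Fin m → ι)) ℝ where
  toFun T := of fun p q => contrForm T m 0 (altProj (toTensor (Pi.single p 1)))
    (altProj (toTensor (Pi.single q 1)))
  map_add' S T := by
    ext p q
    simp [contrForm_add_matrix]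
  map_smul' c T := by
    ext p q
    simp [contrForm_smul_matrix]

theorem altGram_eq {T : Matrix ι ι ℝ} (hT : T.IsSymm) :
    altGram m T = LinearMap.toMatrix₂' ℝ (gramBilin m hT) := by
  ext p q
  rw [LinearMap.toMatrix₂'_apply]
  rfl

theorem dotProduct_altGram {T : Matrix ι ι ℝ} (hT : T.IsSymm)
    (x : (Fin m → ι) × (Fin m → ι) → ℝ) :
    x ⬝ᵥ altGram m T *ᵥ x = contrForm T m 0 (altProj (toTensor x)) (altProj (toTensor x)) := by
  rw [altGram_eq hT, ← toLinearMap₂'_apply', toLinearMap₂'_toMatrix']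
  rfl

theorem altGram_isSymm {T : Matrix ι ι ℝ} (hT : T.IsSymm) : (altGram m T).IsSymm := by
  ext p q
  exact contrForm_comm hT _ _ _ _

/-- Composing with `altProj` avoids choosing a basis of the alternating tensors: the projection
lands in them and acts on them as a positive scalar. -/
theorem posSemidef_altGram_iff {T : Matrix ι ι ℝ} (hT : T.IsSymm) :
    (altGram m T).PosSemidef ↔ ∀ u, IsAltSymm u → 0 ≤ contrForm T m 0 u u := by
  constructor
  · intro h u hu
    have h1 := h.dotProduct_mulVec_nonneg fun p => u p.1 p.2
    rw [star_trivial, dotProduct_altGram hT,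
      show toTensor (fun p : (Fin m → ι) × (Fin m → ι) => u p.1 p.2) = u from rfl,
      hu.altProj_eq, contrForm_smul_left, contrForm_comm hT, contrForm_smul_left] at h1
    have h2 : (0 : ℝ) < 2 * (m ! : ℝ) ^ 2 := by positivity
    exact nonneg_of_mul_nonneg_right (nonneg_of_mul_nonneg_right h1 h2) h2
  · intro h
    refine PosSemidef.of_dotProduct_mulVec_nonneg (isHermitian_iff_isSymm.mpr (altGram_isSymm hT))
      fun x => ?_
    rw [star_trivial, dotProduct_altGram hT]
    exact h _ (altProj_isAltSymm _)

end Gram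

theorem posSemidef_altGram_iff_noPosRoot {d k : ℕ} (hk : k ≤ d) {T : Matrix (Fin d) (Fin d) ℝ}
    (hT : T.IsSymm) : (altGram (k + 1) T).PosSemidef ↔ NoPosRoot k (-T).charpoly := by
  rw [posSemidef_altGram_iff hT]
  exact ⟨noPosRoot_of_contrForm_nonneg hk hT, fun h _ hu => contrForm_nonneg hT h hu⟩

/-! ### Reduction to univariate polynomials -/

section Univariate

variable {n d : ℕ}

/-- Substitution of `t • e - a`, as a polynomial in `t`. -/
noncomputable def lineHom (e a : Fin n → ℝ) : MvPolynomial (Fin n) ℝ →ₐ[ℝ] ℝ[X] :=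
  MvPolynomial.aeval fun i => X * C (e i) - C (a i)

theorem eval_lineHom (e a : Fin n → ℝ) (t : ℝ) (h : MvPolynomial (Fin n) ℝ) :
    (lineHom e a h).eval t = MvPolynomial.eval (fun i => t * e i - a i) h := by
  have : (Polynomial.aeval t).comp (lineHom e a) =
      MvPolynomial.aeval (R := ℝ) fun i => t * e i - a i := by
    ext i
    simp [lineHom]
    ring
  have h2 := DFunLike.congr_fun this h
  rw [AlgHom.comp_apply, Polynomial.coe_aeval_eq_eval] at h2
  rw [h2]
  exact DFunLike.congr_fun (MvPolynomial.coe_aeval_eq_eval _) h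

theorem aeval_lineHom (e a : Fin n → ℝ) (z : ℂ) (h : MvPolynomial (Fin n) ℝ) :
    Polynomial.aeval z (lineHom e a h) =
      MvPolynomial.aeval (fun i => z * (e i : ℂ) - (a i : ℂ)) h := by
  have : (Polynomial.aeval z).comp (lineHom e a) =
      MvPolynomial.aeval (R := ℝ) fun i => z * (e i : ℂ) - (a i : ℂ) := by
    ext i
    simp [lineHom]
    ring
  exact DFunLike.congr_fun this h

/-- The chain rule along the line `t e - a`, whose velocity is `e`. -/
theorem lineHom_dirDeriv (e a : Fin n → ℝ) (h : MvPolynomial (Fin n) ℝ) :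
    lineHom e a (dirDeriv e h) = derivative (lineHom e a h) := by
  induction h using MvPolynomial.induction_on with
  | C c => simp [dirDeriv, lineHom]
  | add p q hp hq =>
    have : dirDeriv e (p + q) = dirDeriv e p + dirDeriv e q := by
      simp [dirDeriv, mul_add, Finset.sum_add_distrib]
    rw [this, map_add, hp, hq, map_add, map_add]
  | mul_X p i hp =>
    have : dirDeriv e (p * MvPolynomial.X i) =
        dirDeriv e p * MvPolynomial.X i + p * MvPolynomial.C (e i) := by
      simp only [dirDeriv, Derivation.leibniz, MvPolynomial.pderiv_X, smul_eq_mul, mul_add,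
        Finset.sum_add_distrib, Finset.sum_mul]
      rw [add_comm]
      congr 1
      · exact Finset.sum_congr rfl fun j _ => by ring
      · rw [Finset.sum_eq_single_of_mem i (mem_univ i)]
        · simp [mul_comm]
        · intro j _ hj
          simp [hj]
    rw [this, map_add, map_mul, map_mul, map_mul, hp, derivative_mul]
    simp [lineHom]

theorem lineHom_renegarDeriv (e a : Fin n → ℝ) (k : ℕ) (h : MvPolynomial (Fin n) ℝ) :
    lineHom e a (renegarDeriv e k h) = derivative^[k] (lineHom e a h) := by
  induction k with
  | zero => rfl
  | succ k ih =>
    rw [renegarDeriv, Function.iterate_succ_apply', Function.iterate_succ_apply',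
      lineHom_dirDeriv, ← ih, renegarDeriv]

theorem eval_det_linearPencil (A : Fin n → Matrix (Fin d) (Fin d) ℝ) (x : Fin n → ℝ) :
    MvPolynomial.eval x (linearPencil A).det = (pencilAt A x).det := by
  rw [RingHom.map_det]
  congr 1
  ext p q
  simp [linearPencil, pencilAt, Matrix.sum_apply]

theorem isHomogeneous_det_linearPencil (A : Fin n → Matrix (Fin d) (Fin d) ℝ) :
    (linearPencil A).det.IsHomogeneous d := by
  have hentry : ∀ p q, (linearPencil A p q).IsHomogeneous 1 := by
    intro p q
    rw [linearPencil, Matrix.sum_apply]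
    refine MvPolynomial.IsHomogeneous.sum _ _ _ fun i _ => ?_
    rw [Matrix.smul_apply, smul_eq_mul, map_apply]
    simpa using (MvPolynomial.isHomogeneous_X ℝ i).mul (MvPolynomial.isHomogeneous_C (Fin n) (A i p q))
  rw [det_apply]
  refine MvPolynomial.IsHomogeneous.sum _ _ _ fun σ _ => ?_
  have h : (∏ i, linearPencil A (σ i) i).IsHomogeneous d := by
    simpa using MvPolynomial.IsHomogeneous.prod univ (fun i => linearPencil A (σ i) i)
      (fun _ => 1) fun i _ => hentry _ _
  rcases Int.units_eq_one_or (Equiv.Perm.sign σ) with hσ | hσ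
  · rwa [hσ, one_smul]
  · rw [hσ, Units.neg_smul, one_smul]
    exact h.neg

theorem isHomogeneous_renegarDeriv (e : Fin n → ℝ) {h : MvPolynomial (Fin n) ℝ} {m : ℕ}
    (hh : h.IsHomogeneous m) (k : ℕ) : (renegarDeriv e k h).IsHomogeneous (m - k) := by
  induction k with
  | zero => exact hh
  | succ k ih =>
    rw [renegarDeriv, Function.iterate_succ_apply', ← renegarDeriv, dirDeriv]
    refine MvPolynomial.IsHomogeneous.sum _ _ _ fun i _ => ?_
    simpa [Nat.sub_sub] using (MvPolynomial.isHomogeneous_C (Fin n) (e i)).mul ih.pderiv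

theorem pencilAt_isSymm {A : Fin n → Matrix (Fin d) (Fin d) ℝ} (hA : ∀ i, (A i).IsSymm)
    (a : Fin n → ℝ) : (pencilAt A a).IsSymm := by
  rw [Matrix.IsSymm, pencilAt, transpose_sum]
  exact Finset.sum_congr rfl fun i _ => by rw [transpose_smul, (hA i).eq]

/-- A positive definite matrix is congruent to the identity. -/
theorem Matrix.PosDef.exists_congr_one {M : Matrix (Fin d) (Fin d) ℝ} (hM : M.PosDef) :
    ∃ G : Matrix (Fin d) (Fin d) ℝ, G * M * Gᵀ = 1 := by
  obtain ⟨O, a, hO, rfl⟩ := (isHermitian_iff_isSymm.mp hM.1).exists_diagonalization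
  have hO' : O * Oᵀ = 1 := mul_eq_one_comm.mp hO
  have ha : ∀ i, 0 < a i := by
    intro i
    have h1 : O *ᵥ (Oᵀ *ᵥ Pi.single i 1) = Pi.single i 1 := by
      rw [mulVec_mulVec, hO', one_mulVec]
    have h2 := hM.dotProduct_mulVec_pos (x := Oᵀ *ᵥ Pi.single i 1) fun h => by
      rw [h, mulVec_zero] at h1
      exact one_ne_zero ((congrFun h1 i).symm.trans rfl |>.symm.trans (by simp) |>.symm)
    rw [star_trivial, ← mulVec_mulVec, ← mulVec_mulVec, h1, mulVec_transpose,
      ← dotProduct_mulVec, mulVec_mulVec, hO', one_mulVec] at h2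
    simpa using h2
  refine ⟨diagonal (fun i => (√(a i))⁻¹) * O, ?_⟩
  rw [transpose_mul, diagonal_transpose]
  calc _ = diagonal (fun i => (√(a i))⁻¹) * (O * Oᵀ) * diagonal a * (O * Oᵀ) *
        diagonal (fun i => (√(a i))⁻¹) := by simp only [Matrix.mul_assoc]
    _ = 1 := by
      rw [hO', Matrix.mul_one, Matrix.mul_one, diagonal_mul_diagonal, diagonal_mul_diagonal,
        ← diagonal_one]
      congr 1
      ext i
      have h := (Real.sqrt_pos.mpr (ha i)).ne'
      have h2 := Real.mul_self_sqrt (ha i).le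
      field_simp
      rw [pow_two, h2]

theorem lineHom_det (A : Fin n → Matrix (Fin d) (Fin d) ℝ) {e : Fin n → ℝ}
    {G : Matrix (Fin d) (Fin d) ℝ} (hG : G * pencilAt A e * Gᵀ = 1) (a : Fin n → ℝ) :
    lineHom e a (linearPencil A).det =
      C ((G.det ^ 2)⁻¹) * (G * pencilAt A a * Gᵀ).charpoly := by
  have hdet : G.det ≠ 0 := by
    intro h
    have := congrArg det hG
    rw [det_mul, det_mul, h, det_one] at this
    simp at this
  refine Polynomial.funext fun t => ?_
  rw [eval_lineHom, eval_det_linearPencil, eval_mul, eval_C, eval_charpoly]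
  have h1 : pencilAt A (fun i => t * e i - a i) = t • pencilAt A e - pencilAt A a := by
    simp only [pencilAt, sub_smul, Finset.sum_sub_distrib, mul_smul, Finset.smul_sum]
  have h2 : scalar (Fin d) t - G * pencilAt A a * Gᵀ =
      G * pencilAt A (fun i => t * e i - a i) * Gᵀ := by
    rw [h1, Matrix.mul_sub, Matrix.sub_mul, Matrix.mul_smul, Matrix.smul_mul, hG,
      smul_one_eq_diagonal]
    rfl
  rw [h2, det_mul, det_mul, det_transpose]
  field_simp

end Univariate

/-! ### Real-rootedness, reflection and the main theorem -/

/-- Rolle's theorem, counted with multiplicity: differentiation loses at most one real root while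
the degree drops. -/
theorem Polynomial.Splits.derivative_real {p : ℝ[X]} (hp : p.Splits) : (derivative p).Splits := by
  rw [splits_iff_card_roots] at hp ⊢
  have h1 := card_roots_le_derivative p
  have h2 := card_roots' (derivative p)
  have h3 := natDegree_derivative_le p
  omega

theorem Polynomial.Splits.iterate_derivative_real {p : ℝ[X]} (hp : p.Splits) (k : ℕ) :
    (derivative^[k] p).Splits := by
  induction k with
  | zero => exact hp
  | succ k ih => rw [Function.iterate_succ_apply']; exact ih.derivative_real

theorem im_eq_zero_of_aeval_eq_zero {p : ℝ[X]} (hp : p.Splits) (h0 : p ≠ 0) {z : ℂ}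
    (hz : aeval z p = 0) : z.im = 0 := by
  rw [hp.eq_prod_roots, map_mul, aeval_C, map_multiset_prod, Multiset.map_map, mul_eq_zero] at hz
  rcases hz with hz | hz
  · simp [h0] at hz
  · rw [Multiset.prod_eq_zero_iff, Multiset.mem_map] at hz
    obtain ⟨r, -, hr⟩ := hz
    simp only [Function.comp, map_sub, aeval_X, aeval_C, sub_eq_zero] at hr
    rw [hr]
    exact Complex.ofReal_im r

theorem iterate_derivative_comp_neg (p : ℝ[X]) (k : ℕ) :
    derivative^[k] (p.comp (-X)) = (-1) ^ k * (derivative^[k] p).comp (-X) := by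
  induction k with
  | zero => simp
  | succ k ih =>
    rw [Function.iterate_succ_apply', ih, Function.iterate_succ_apply', derivative_mul,
      derivative_comp]
    have : derivative ((-1 : ℝ[X]) ^ k) = 0 := by
      rw [show (-1 : ℝ[X]) ^ k = C ((-1) ^ k) by simp, derivative_C]
    rw [this]
    simp only [derivative_neg, derivative_X]
    ring

theorem noPosRoot_charpoly_neg {d : ℕ} (k : ℕ) (T : Matrix (Fin d) (Fin d) ℝ) :
    NoPosRoot k (-T).charpoly ↔
      ∀ t : ℝ, (derivative^[k] T.charpoly).eval t = 0 → 0 ≤ t := by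
  have h1 : (-T).charpoly = C ((-1) ^ d) * T.charpoly.comp (-X) := by
    refine Polynomial.funext fun t => ?_
    have h := det_neg (scalar (Fin d) (-t) - T)
    rw [Fintype.card_fin] at h
    rw [eval_charpoly, eval_mul, eval_C, eval_comp, eval_neg, eval_X, eval_charpoly, ← h,
      map_neg, neg_sub, sub_neg_eq_add, sub_neg_eq_add, add_comm]
  have h2 : ∀ s, (derivative^[k] (-T).charpoly).eval s = 0 ↔
      (derivative^[k] T.charpoly).eval (-s) = 0 := by
    intro s
    rw [h1, iterate_derivative_C_mul, iterate_derivative_comp_neg]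
    simp [eval_comp]
  constructor
  · intro h t ht
    by_contra hneg
    refine h (-t) (by linarith) ((h2 _).mpr ?_)
    rwa [neg_neg]
  · intro h s hs h0
    have := h _ ((h2 s).mp h0)
    linarith

theorem mainTheorem2 (k : ℕ) :
    ∃ C : ℕ, ∀ (n d : ℕ) (A : Fin n → Matrix (Fin d) (Fin d) ℝ) (e : Fin n → ℝ),
      (∀ i, (A i).IsSymm) → (pencilAt A e).PosDef → k ≤ d →
        IsHyperbolic (renegarDeriv e k (linearPencil A).det) e ∧
          ∃ N : ℕ, N ≤ C * d ^ (2 * k + 2) ∧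
            IsSpectrahedralConeOfSize
              (hyperbolicityCone (renegarDeriv e k (linearPencil A).det) e) N := by
  -- The constant is `1`, since the Gram matrix is indexed by pairs of `(k + 1)`-tuples from `Fin
  -- d`.
  refine ⟨1, fun n d A e hA he hk => ?_⟩
  obtain ⟨G, hG⟩ := he.exists_congr_one
  have hdet : 0 < (G.det ^ 2)⁻¹ := by
    have : G.det ≠ 0 := by
      intro h
      have := congrArg det hG
      rw [det_mul, det_mul, h, det_one] at this
      simp at this
    positivity
  have hT : ∀ a, (G * pencilAt A a * Gᵀ).IsSymm := fun a => by
    rw [Matrix.IsSymm, transpose_mul, transpose_mul, transpose_transpose,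
      (pencilAt_isSymm hA a).eq, Matrix.mul_assoc]
  have hline : ∀ a, lineHom e a (renegarDeriv e k (linearPencil A).det) =
      C ((G.det ^ 2)⁻¹) * derivative^[k] (G * pencilAt A a * Gᵀ).charpoly := fun a => by
    rw [lineHom_renegarDeriv, lineHom_det A hG, iterate_derivative_C_mul]
  refine ⟨⟨⟨_, isHomogeneous_renegarDeriv e (isHomogeneous_det_linearPencil A) k⟩, ?_, ?_⟩, ?_⟩
  -- The value at `e` is read off on the line with `a = 0` at `t = 1`, where the characteristic
  -- polynomial is `X ^ d`; the falling factorial that arises is positive because `k ≤ d`.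
  · have h1 := eval_lineHom e 0 1 (renegarDeriv e k (linearPencil A).det)
    have h2 : pencilAt A (0 : Fin n → ℝ) = 0 := by simp [pencilAt]
    rw [hline, h2, Matrix.mul_zero, Matrix.zero_mul, charpoly_zero, Fintype.card_fin,
      iterate_derivative_X_pow_eq_natCast_mul] at h1
    simp only [one_mul, Pi.zero_apply, sub_zero, eval_mul, eval_C, eval_natCast, eval_pow, eval_X,
      one_pow, mul_one] at h1
    rw [show (fun i => e i) = e from rfl] at h1
    rw [← h1]
    exact mul_pos hdet (Nat.cast_pos.mpr (Nat.descFactorial_pos.mpr hk))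
  · intro a z hz
    rw [← aeval_lineHom, hline, map_mul, aeval_C, mul_eq_zero] at hz
    have hne : algebraMap ℝ ℂ ((G.det ^ 2)⁻¹) ≠ 0 := by
      rw [Ne, map_eq_zero]; exact hdet.ne'
    have hsplit := (isHermitian_iff_isSymm.mpr (hT a)).splits_charpoly
    refine im_eq_zero_of_aeval_eq_zero (hsplit.iterate_derivative_real k)
      (iterate_derivative_ne_zero (charpoly_monic _).ne_zero ?_) (hz.resolve_left hne)
    rw [charpoly_natDegree_eq_dim, Fintype.card_fin]
    exact hk
  · set I := (Fin (k + 1) → Fin d) × (Fin (k + 1) → Fin d)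
    have hcard : Fintype.card I = d ^ (2 * k + 2) := by
      rw [Fintype.card_prod, Fintype.card_fun, Fintype.card_fin, Fintype.card_fin]
      ring
    refine ⟨Fintype.card I, by rw [hcard, one_mul],
      fun i => (altGram (k + 1) (G * A i * Gᵀ)).submatrix (Fintype.equivFin I).symm
        (Fintype.equivFin I).symm, fun i => ?_, ?_⟩
    · have : (G * A i * Gᵀ).IsSymm := by
        rw [Matrix.IsSymm, transpose_mul, transpose_mul, transpose_transpose, (hA i).eq,
          Matrix.mul_assoc]
      rw [Matrix.IsSymm, transpose_submatrix, (altGram_isSymm this).eq]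
    · ext a
      have hsum : pencilAt (fun i => (altGram (k + 1) (G * A i * Gᵀ)).submatrix
          (Fintype.equivFin I).symm (Fintype.equivFin I).symm) a =
          (altGram (k + 1) (G * pencilAt A a * Gᵀ)).submatrix (Fintype.equivFin I).symm
          (Fintype.equivFin I).symm := by
        have h1 : G * pencilAt A a * Gᵀ = ∑ i, a i • (G * A i * Gᵀ) := by
          simp only [pencilAt, Matrix.mul_sum, Matrix.sum_mul, Matrix.mul_smul, Matrix.smul_mul]
        rw [h1, map_sum]
        ext p q
        simp only [pencilAt, Matrix.sum_apply, Matrix.smul_apply, submatrix_apply, map_smul]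
      rw [Set.mem_ofPred_eq, hsum, posSemidef_submatrix_equiv,
        posSemidef_altGram_iff_noPosRoot hk (hT a), noPosRoot_charpoly_neg]
      refine forall_congr' fun t => ?_
      rw [← eval_lineHom, hline, eval_mul, eval_C, mul_eq_zero, or_iff_right hdet.ne']
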